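/- Let PA be first-order Peano arithmetic (Mendelson's system S). For a PA-formula $A(x)$ with at most one free variable, say that $A(x)$ is *uniformly true* if some Turing-computable function computes, from $k$, the truth value of $A(k)$ in the standard interpretation, and returns "true" for every $k\in\mathbb N$. Say that *the CCM Thesis holds for $A(x)$* if: $A(x)$ is PA-provable if and only if it is uniformly true. The *CCM Thesis* ("Turing-computability is equivalent to PA-provability") says that it holds for every such formula. Let $T$ be a Turing machine, $G:\mathbb N^2\to\mathbb N$ a recursive function such that $T$ halts on input $a$ if and only if $G(a,y)=0$ for some $y$, and $H(x,y)$ a PA-formula, with no other free variables, that expresses the relation $G(x,y)\neq 0$ in PA (that is, for all $m,n$, PA proves $H(\bar m,\bar n)$ if $G(m,n)\ne0$, and proves $\neg H(\bar m,\bar n)$ if $G(m,n)=0$). For $a\in\mathbb N$ let $h_a$ be the Gödel number of $H(\bar a,y)$, let $T_1(a,y)$ be $0$ if $G(a,y)=0$, otherwise $2$ if the run of $T$ on $a$ has repeated an instantaneous description within its first $y$ steps, and otherwise $1$; let $T_2(a,y)$ be $0$ if $y$ is the Gödel number of a PA-proof of the formula with Gödel number $h_a$, and $1$ otherwise. Run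 $T_1$ and $T_2$ in parallel on $a$ for $y=0,1,2,\dots$ until $T_1(a,y)\neq1$ or $T_2(a,y)=0$, and answer "halts" if then $T_1(a,y)=0$, and "does not halt" otherwise. **Theorem 1.** 1. $T_1$ and $T_2$ are Turing-computable. 2. For every $a$: if the parallel search on $a$ stops, its answer to the question whether $T$ halts on $a$ is correct. It stops if the CCM Thesis holds for the formula $H(\bar a,y)$, and also if $T$ on input $a$ is ever twice in the same instantaneous description. 3. Consequently the CCM Thesis implies that the Halting problem is effectively solvable: if the CCM Thesis holds, then every Turing machine $T$ has $G$ and $H$ as above; for all such $T,G,H$ and every input $a$ the parallel search stops with the correct answer; and the set of all pairs $(T,a)$ such that $T$ halts on $a$ is decidable. -/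

import Mathlib

namespace HaltPA

/-! ### Turing machines -/

/-- A Turing machine, given by its finite list of quadruples `((q, s), (act, q'))`: in state `q`,
scanning the symbol `s`, perform `act` and pass to state `q'`. The action `Sum.inl s'` prints `s'`,
`Sum.inr true` moves one square to the right, `Sum.inr false` one square to the left.
States and symbols are natural numbers; the state `0` is initial, the symbol `0` is the blank.
If several quadruples have the same first half, the first one counts. -/
abbrev TM : Type := List ((ℕ × ℕ) × ((ℕ ⊕ Bool) × ℕ))

/-- An instantaneous description: the state, the tape to the left of the head (nearest square
first), the scanned symbol, the tape to the right of the head (nearest square first).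
The squares that are not listed are blank. -/
abbrev Config : Type := ℕ × List ℕ × ℕ × List ℕ

namespace TM

/-- The effect of an action, followed by the passage to state `q'`. -/
def act (q' : ℕ) (l : List ℕ) (s : ℕ) (r : List ℕ) : ℕ ⊕ Bool → Config
  | Sum.inl s' => (q', l, s', r)
  | Sum.inr true => (q', s :: l, r.headD 0, r.tail)
  | Sum.inr false => (q', l.tail, l.headD 0, s :: r)

/-- One step of the machine; `none` if no quadruple applies. -/
def step (T : TM) (c : Config) : Option Config :=
  (List.lookup (c.1, c.2.2.1) T).map fun p => act p.2 c.2.1 c.2.2.1 c.2.2.2 p.1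

/-- The initial description on input `a`: the state `0`, and `a + 1` strokes `1` on an otherwise
blank tape, the head being on the leftmost stroke. -/
def init (a : ℕ) : Config := (0, [], 1, List.replicate a 1)

/-- The instantaneous description after `n` steps on input `a`; `none` if the machine has stopped
before completing `n` steps. -/
def configAt (T : TM) (a : ℕ) : ℕ → Option Config
  | 0 => some (init a)
  | n + 1 => (configAt T a n).bind (step T)

/-- The machine halts on input `a`. -/
def HaltsOn (T : TM) (a : ℕ) : Prop := ∃ n, configAt T a n = none

/-- Within its first `n` steps on input `a` the machine is twice in the same instantaneous
description. -/
def RepeatsBy (T : TM) (a n : ℕ) : Prop :=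
  ∃ i j, i < j ∧ j ≤ n ∧ configAt T a i ≠ none ∧ configAt T a i = configAt T a j

end TM

/-! ### First-order Peano arithmetic (Mendelson's system S) -/

/-- Terms of PA. -/
inductive Term : Type
  | var (i : ℕ)
  | zero
  | succ (t : Term)
  | add (t u : Term)
  | mul (t u : Term)

/-- Formulas of PA. -/
inductive Formula : Type
  | eq (t u : Term)
  | neg (A : Formula)
  | imp (A B : Formula)
  | all (i : ℕ) (A : Formula)

namespace Term

/-- The variable `i` occurs in the term. -/
def Occurs (i : ℕ) : Term → Prop
  | var j => j = i
  | zero => False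
  | succ t => t.Occurs i
  | add t u => t.Occurs i ∨ u.Occurs i
  | mul t u => t.Occurs i ∨ u.Occurs i

/-- Substitution of `s` for the variable `i`. -/
def subst (i : ℕ) (s : Term) : Term → Term
  | var j => if j = i then s else var j
  | zero => zero
  | succ t => succ (subst i s t)
  | add t u => add (subst i s t) (subst i s u)
  | mul t u => mul (subst i s t) (subst i s u)

/-- The numeral of `n`. -/
def numeral : ℕ → Term
  | 0 => zero
  | n + 1 => succ (numeral n)

/-- Value in the standard interpretation. -/
def val (v : ℕ → ℕ) : Term → ℕ
  | var j => v j
  | zero => 0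
  | succ t => t.val v + 1
  | add t u => t.val v + u.val v
  | mul t u => t.val v * u.val v

/-- Gödel number of a term. -/
def code : Term → ℕ
  | var j => Nat.pair 0 j
  | zero => Nat.pair 1 0
  | succ t => Nat.pair 2 t.code
  | add t u => Nat.pair 3 (Nat.pair t.code u.code)
  | mul t u => Nat.pair 4 (Nat.pair t.code u.code)

end Term

namespace Formula

/-- The variable `i` occurs free in the formula. -/
def Free (i : ℕ) : Formula → Prop
  | eq t u => t.Occurs i ∨ u.Occurs i
  | neg A => A.Free i
  | imp A B => A.Free i ∨ B.Free i
  | all j A => j ≠ i ∧ A.Free i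

/-- Substitution of the term `s` for the free occurrences of the variable `i`. -/
def subst (i : ℕ) (s : Term) : Formula → Formula
  | eq t u => eq (Term.subst i s t) (Term.subst i s u)
  | neg A => neg (A.subst i s)
  | imp A B => imp (A.subst i s) (B.subst i s)
  | all j A => if j = i then all j A else all j (A.subst i s)

/-- The term `s` is free for the variable `i` in the formula: no free occurrence of `i` lies in the
scope of a quantifier on a variable of `s`. -/
def FreeFor (s : Term) (i : ℕ) : Formula → Prop
  | eq _ _ => True
  | neg A => A.FreeFor s i
  | imp A B => A.FreeFor s i ∧ B.FreeFor s i
  | all j A => ¬ (all j A).Free i ∨ (¬ s.Occurs j ∧ A.FreeFor s i)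

/-- Satisfaction in the standard interpretation. -/
def Sat : (ℕ → ℕ) → Formula → Prop
  | v, eq t u => t.val v = u.val v
  | v, neg A => ¬ A.Sat v
  | v, imp A B => A.Sat v → B.Sat v
  | v, all i A => ∀ n, A.Sat (Function.update v i n)

/-- Gödel number of a formula. -/
def code : Formula → ℕ
  | eq t u => Nat.pair 0 (Nat.pair t.code u.code)
  | neg A => Nat.pair 1 A.code
  | imp A B => Nat.pair 2 (Nat.pair A.code B.code)
  | all i A => Nat.pair 3 (Nat.pair i A.code)

end Formula

open Term Formula in
/-- The axioms of PA: the logical axioms, the axioms for equality, successor, addition and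
multiplication, and the induction schema. -/
inductive IsAxiom : Formula → Prop
  | a1 (A B : Formula) : IsAxiom (imp A (imp B A))
  | a2 (A B C : Formula) :
      IsAxiom (imp (imp A (imp B C)) (imp (imp A B) (imp A C)))
  | a3 (A B : Formula) : IsAxiom (imp (imp (neg B) (neg A)) (imp (imp (neg B) A) B))
  | a4 (i : ℕ) (A : Formula) (t : Term) (h : A.FreeFor t i) :
      IsAxiom (imp (all i A) (A.subst i t))
  | a5 (i : ℕ) (A B : Formula) (h : ¬ A.Free i) :
      IsAxiom (imp (all i (imp A B)) (imp A (all i B)))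
  | s1 : IsAxiom (imp (eq (var 1) (var 2)) (imp (eq (var 1) (var 3)) (eq (var 2) (var 3))))
  | s2 : IsAxiom (imp (eq (var 1) (var 2)) (eq (succ (var 1)) (succ (var 2))))
  | s3 : IsAxiom (neg (eq zero (succ (var 1))))
  | s4 : IsAxiom (imp (eq (succ (var 1)) (succ (var 2))) (eq (var 1) (var 2)))
  | s5 : IsAxiom (eq (add (var 1) zero) (var 1))
  | s6 : IsAxiom (eq (add (var 1) (succ (var 2))) (succ (add (var 1) (var 2))))
  | s7 : IsAxiom (eq (mul (var 1) zero) zero)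
  | s8 : IsAxiom (eq (mul (var 1) (succ (var 2))) (add (mul (var 1) (var 2)) (var 1)))
  | s9 (i : ℕ) (A : Formula) :
      IsAxiom (imp (A.subst i zero)
        (imp (all i (imp A (A.subst i (succ (var i))))) (all i A)))

/-- `A` is an axiom or follows from members of `l` by modus ponens or by generalisation. -/
def Justified (l : List Formula) (A : Formula) : Prop :=
  IsAxiom A ∨ (∃ B ∈ l, Formula.imp B A ∈ l) ∨ ∃ B ∈ l, ∃ i, A = Formula.all i B

/-- Proof sequences of PA, written with the last formula first: each formula is justified by those
that precede it in the proof. -/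
def IsProofSeq : List Formula → Prop
  | [] => True
  | A :: l => Justified l A ∧ IsProofSeq l

/-- `l` is a proof sequence whose last formula is `A`. -/
def IsProofOf (l : List Formula) (A : Formula) : Prop :=
  IsProofSeq l ∧ l.head? = some A

/-- PA-provability. -/
def Provable (A : Formula) : Prop := ∃ l, IsProofOf l A

/-- Gödel number of a sequence of formulas. -/
def seqCode (l : List Formula) : ℕ := Encodable.encode (l.map Formula.code)

/-- Gödel's relation `xBy`: `x` is the Gödel number of a proof sequence of the formula with Gödel
number `y`. -/
def ProofRel (x y : ℕ) : Prop := ∃ l A, seqCode l = x ∧ A.code = y ∧ IsProofOf l A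

/-- The formula `H(x, y)`, with `x = var 0` and `y = var 1`, expresses the relation `R` in PA. -/
def Expresses (H : Formula) (R : ℕ → ℕ → Prop) : Prop :=
  (∀ i, H.Free i → i = 0 ∨ i = 1) ∧
    ∀ m n,
      (R m n → Provable ((H.subst 0 (Term.numeral m)).subst 1 (Term.numeral n))) ∧
      (¬ R m n →
        Provable (Formula.neg ((H.subst 0 (Term.numeral m)).subst 1 (Term.numeral n))))

/-! ### The thesis -/

/-- `A(k)`, the formula `A` with `k` as the value of its variable `i`, holds in the standard
interpretation. -/
def HoldsAt (A : Formula) (i k : ℕ) : Prop := A.Sat (Function.update (fun _ => 0) i k)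

open Classical in
/-- The formula `A(x)`, `x = var i`, viewed as a Boolean function in the standard interpretation,
is computed by some program, which returns the value true on every input. -/
def UniformlyTrue (A : Formula) (i : ℕ) : Prop :=
  ∃ U : Nat.Partrec.Code,
    (∀ k, U.eval k = Part.some (if HoldsAt A i k then 1 else 0)) ∧
    ∀ k, U.eval k = Part.some 1

/-- The thesis for one formula `A(x)`, `x = var i`: it is PA-provable if and only if it is
Turing-computable as true for every input. -/
def CCMAt (A : Formula) (i : ℕ) : Prop := Provable A ↔ UniformlyTrue A i

/-- The CCM Thesis: the equivalence for all formulas with at most one free variable. -/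
def CCMThesis : Prop :=
  ∀ (A : Formula) (i : ℕ), (∀ j, A.Free j → j = i) → CCMAt A i

/-! ### The two machines run in parallel -/

/-- `G` is recursive, the machine `T` halts on `a` iff `G(a, y) = 0` for some `y`, and `H(x, y)`
expresses `G(x, y) ≠ 0` in PA. -/
structure Presents (T : TM) (G : ℕ → ℕ → ℕ) (H : Formula) : Prop where
  computable : Computable₂ G
  halts_iff : ∀ a, T.HaltsOn a ↔ ∃ y, G a y = 0
  expresses : Expresses H fun x y => ¬ G x y = 0

/-- The formula `H(a, y)`, with the numeral of `a` for `x`; its free variable is `y = var 1`. -/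
def nonHalting (H : Formula) (a : ℕ) : Formula := H.subst 0 (Term.numeral a)

open Classical in
/-- On `(a, y)` the first program returns `0` if `G(a, y) = 0`, otherwise `2` if `T`, run on `a`, has
repeated an instantaneous description within `y` steps, and otherwise `1`. The second one computes the characteristic function (value `0` for true) of the relation
"`y` is the Gödel number of a PA-proof of `H(a, y)`". -/
structure IsDuo (T : TM) (G : ℕ → ℕ → ℕ) (H : Formula) (T₁ T₂ : Nat.Partrec.Code) : Prop where
  first : ∀ a y, T₁.eval (Nat.pair a y) =
    Part.some (if G a y = 0 then 0 else if T.RepeatsBy a y then 2 else 1)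
  second : ∀ a y, T₂.eval (Nat.pair a y) =
    Part.some (if ProofRel y (nonHalting H a).code then 0 else 1)

/-- Run the two programs simultaneously for `y = 0, 1, 2, …` until the first one returns a value
other than `1` or the second one returns `0`; then answer `true` ("`T` halts on `a`") if the first
one has returned `0`, and `false` otherwise. -/
def parallel (T₁ T₂ : Nat.Partrec.Code) (a : ℕ) : Part Bool :=
  (Nat.rfind fun y =>
      (T₁.eval (Nat.pair a y)).bind fun u =>
        (T₂.eval (Nat.pair a y)).map fun w => decide (u ≠ 1 ∨ w = 0)).bind
    fun y => (T₁.eval (Nat.pair a y)).map fun u => decide (u = 0)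

end HaltPA

open HaltPA

/-! Correctness of the search rests on soundness of PA for the standard model (`Provable.sat`).
Every instance of `H` is provable or refutable according to the relation it expresses, so soundness
gives `H` its intended meaning (`Expresses.holdsAt_iff`). A proof of `H(a, y)` therefore certifies
that `G(a, y)` never vanishes, that is, that `T` does not halt on `a`. A repeated instantaneous
description certifies the same, because the run is then periodic. A zero of `G` certifies halting.

Termination under the thesis: if `G(a, y)` has no zero, then `H(a, y)` is true for every `y`, and
the constant program `1` computes its truth values. The formula is thus uniformly true, and the
thesis makes it provable (`Expresses.provable`). So one of the two programs stops.

The remaining work supplies the data. The proof relation has to be computable: syntax and axioms are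
arithmetized by recursion on Gödel numbers (`primrecRel_proofRel`). Every recursively enumerable set
needs a pair `G`, `H` (`exists_expresses_of_rePred`): by Gödel's β-function the graph of a partial
recursive function is one existential quantifier over a bounded formula (`isSigma_of_partrec`), and
PA decides bounded formulas at numerals (`Bdd.provable_toFormula`).

Decidability for all pairs `(T, a)` is Post's theorem: halting is recursively enumerable, and under
the thesis non-halting is too, as provability of `H(a, y)`, with one `H` that serves all machines.
-/

namespace HaltPA

/-! ### Substitution and satisfaction -/

namespace Term

theorem val_congr {v w : ℕ → ℕ} {t : Term} (h : ∀ i, t.Occurs i → v i = w i) :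
    t.val v = t.val w := by
  induction t with
  | var j => exact h j rfl
  | zero => rfl
  | succ t ih => simp only [val, ih h]
  | add t u iht ihu =>
    simp only [val, iht fun i hi => h i (Or.inl hi), ihu fun i hi => h i (Or.inr hi)]
  | mul t u iht ihu =>
    simp only [val, iht fun i hi => h i (Or.inl hi), ihu fun i hi => h i (Or.inr hi)]

theorem val_subst (v : ℕ → ℕ) (i : ℕ) (s t : Term) :
    (Term.subst i s t).val v = t.val (Function.update v i (s.val v)) := by
  induction t with
  | var j =>
    by_cases h : j = i
    · subst h; simp [subst, val]
    · simp [subst, val, h]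
  | zero => rfl
  | succ t ih => simp only [subst, val, ih]
  | add t u iht ihu => simp only [subst, val, iht, ihu]
  | mul t u iht ihu => simp only [subst, val, iht, ihu]

theorem subst_eq_self {i : ℕ} {s t : Term} (h : ¬ t.Occurs i) : Term.subst i s t = t := by
  induction t with
  | var j => exact if_neg h
  | zero => rfl
  | succ t ih => simp only [subst, ih h]
  | add t u iht ihu =>
    simp only [subst, iht fun hi => h (Or.inl hi), ihu fun hi => h (Or.inr hi)]
  | mul t u iht ihu =>
    simp only [subst, iht fun hi => h (Or.inl hi), ihu fun hi => h (Or.inr hi)]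

@[simp] theorem not_occurs_numeral (i n : ℕ) : ¬ (numeral n).Occurs i := by
  induction n with
  | zero => exact id
  | succ n ih => exact ih

@[simp] theorem numeral_subst (i : ℕ) (s : Term) (n : ℕ) : Term.subst i s (numeral n) = numeral n :=
  subst_eq_self (not_occurs_numeral i n)

@[simp] theorem val_numeral (v : ℕ → ℕ) (n : ℕ) : (numeral n).val v = n := by
  induction n with
  | zero => rfl
  | succ n ih => simp only [numeral, val, ih]

end Term

namespace Formula

theorem sat_congr {A : Formula} : ∀ {v w : ℕ → ℕ}, (∀ i, A.Free i → v i = w i) →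
    (A.Sat v ↔ A.Sat w) := by
  induction A with
  | eq t u =>
    intro v w h
    simp only [Sat, Term.val_congr fun i hi => h i (Or.inl hi),
      Term.val_congr fun i hi => h i (Or.inr hi)]
  | neg A ih => intro v w h; simp only [Sat, ih h]
  | imp A B ihA ihB =>
    intro v w h
    simp only [Sat, ihA fun i hi => h i (Or.inl hi), ihB fun i hi => h i (Or.inr hi)]
  | all j A ih =>
    intro v w h
    refine forall_congr' fun n => ih fun i hi => ?_
    by_cases hij : i = j
    · subst hij; simp
    · simp only [Function.update_of_ne hij]
      exact h i ⟨fun e => hij e.symm, hi⟩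

theorem sat_update_of_not_free {A : Formula} {i : ℕ} (h : ¬ A.Free i) (v : ℕ → ℕ) (n : ℕ) :
    A.Sat (Function.update v i n) ↔ A.Sat v :=
  sat_congr fun j hj => Function.update_of_ne (fun e : j = i => h (e ▸ hj)) _ _

theorem subst_eq_self {A : Formula} {i : ℕ} {s : Term} (h : ¬ A.Free i) : A.subst i s = A := by
  induction A with
  | eq t u =>
    simp only [subst, Term.subst_eq_self fun hi => h (Or.inl hi),
      Term.subst_eq_self fun hi => h (Or.inr hi)]
  | neg A ih => simp only [subst, ih h]
  | imp A B ihA ihB =>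
    simp only [subst, ihA fun hi => h (Or.inl hi), ihB fun hi => h (Or.inr hi)]
  | all j A ih =>
    by_cases hj : j = i
    · simp only [subst, if_pos hj]
    · simp only [subst, if_neg hj, ih fun hi => h ⟨hj, hi⟩]

/-- `FreeFor` is what the quantifier case needs: if `j` does not occur in `s`, changing the value of
`j` leaves the value of `s` alone; otherwise `i` is not free and nothing is substituted. -/
theorem sat_subst {A : Formula} {i : ℕ} {s : Term} : ∀ {v : ℕ → ℕ}, A.FreeFor s i →
    ((A.subst i s).Sat v ↔ A.Sat (Function.update v i (s.val v))) := by
  induction A with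
  | eq t u => intro v _; simp only [subst, Sat, Term.val_subst]
  | neg A ih => intro v h; simp only [subst, Sat, ih (v := v) h]
  | imp A B ihA ihB => intro v h; simp only [subst, Sat, ihA (v := v) h.1, ihB (v := v) h.2]
  | all j A ih =>
    intro v h
    rcases h with h | ⟨h₁, h₂⟩
    · rw [subst_eq_self h, sat_update_of_not_free h]
    · by_cases hj : j = i
      · subst hj
        simp only [subst, if_true, Sat, Function.update_idem]
      · simp only [subst, if_neg hj, Sat]
        refine forall_congr' fun n => ?_
        rw [ih h₂, Function.update_comm hj, Term.val_congr (w := v)]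
        exact fun k hk => Function.update_of_ne (fun e : k = j => h₁ (e ▸ hk)) _ _

/-- A term without variables other than `i` is free for `i` in every formula. -/
theorem freeFor_of_occurs {i : ℕ} {s : Term} (h : ∀ j, s.Occurs j → j = i) (A : Formula) :
    A.FreeFor s i := by
  induction A with
  | eq t u => trivial
  | neg A ih => exact ih
  | imp A B ihA ihB => exact ⟨ihA, ihB⟩
  | all j A ih =>
    by_cases hj : j = i
    · exact Or.inl fun h => h.1 hj
    · exact Or.inr ⟨fun e => hj (h j e), ih⟩

theorem freeFor_numeral (A : Formula) (i n : ℕ) : A.FreeFor (Term.numeral n) i :=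
  freeFor_of_occurs (fun j hj => (Term.not_occurs_numeral j n hj).elim) A

theorem sat_subst_numeral (A : Formula) (i n : ℕ) (v : ℕ → ℕ) :
    (A.subst i (Term.numeral n)).Sat v ↔ A.Sat (Function.update v i n) := by
  rw [sat_subst (freeFor_numeral A i n), Term.val_numeral]

end Formula

/-! ### Soundness and consistency -/

theorem IsAxiom.sat {A : Formula} (h : IsAxiom A) (v : ℕ → ℕ) : A.Sat v := by
  cases h with
  | a1 A B => exact fun a _ => a
  | a2 A B C => exact fun f g a => f a (g a)
  | a3 A B => exact fun f g => by_contra fun nb => f nb (g nb)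
  | a4 i A t h => exact fun f => (Formula.sat_subst h).2 (f _)
  | a5 i A B h => exact fun f a n => f n ((Formula.sat_update_of_not_free h v n).2 a)
  | s1 => exact fun e f => e.symm.trans f
  | s2 => exact fun e => congrArg (· + 1) e
  | s3 => exact fun e => Nat.succ_ne_zero _ e.symm
  | s4 => exact fun e => Nat.succ.inj e
  | s5 => rfl
  | s6 => rfl
  | s7 => rfl
  | s8 => rfl
  | s9 i A =>
    intro h0 hs n
    replace h0 := (Formula.sat_subst_numeral A i 0 v).1 h0
    induction n with
    | zero => exact h0
    | succ n ih =>
      have := hs n ih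
      rw [Formula.sat_subst (Formula.freeFor_of_occurs (s := (Term.var i).succ) (fun j (h : i = j) => h.symm) A)] at this
      simpa [Term.val] using this

theorem IsProofSeq.sat {l : List Formula} (h : IsProofSeq l) :
    ∀ A ∈ l, ∀ v : ℕ → ℕ, A.Sat v := by
  induction l with
  | nil => simp
  | cons A l ih =>
    intro B hB v
    rcases List.mem_cons.1 hB with rfl | hB
    · rcases h.1 with h' | ⟨C, hC, hCB⟩ | ⟨C, hC, i, rfl⟩
      · exact h'.sat v
      · exact ih h.2 _ hCB v (ih h.2 _ hC v)
      · exact fun n => ih h.2 _ hC _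
    · exact ih h.2 B hB v

theorem Provable.sat {A : Formula} (h : Provable A) (v : ℕ → ℕ) : A.Sat v := by
  obtain ⟨l, h, hl⟩ := h
  exact h.sat A (List.mem_of_mem_head? (hl ▸ rfl)) v

/-! ### Derived rules -/

theorem IsProofSeq.append {l m : List Formula} (hl : IsProofSeq l) (hm : IsProofSeq m) :
    IsProofSeq (l ++ m) := by
  induction l with
  | nil => exact hm
  | cons A l ih =>
    refine ⟨?_, ih hl.2⟩
    rcases hl.1 with h | ⟨B, hB, hBA⟩ | ⟨B, hB, i, h⟩
    · exact Or.inl h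
    · exact Or.inr (Or.inl ⟨B, List.mem_append_left _ hB, List.mem_append_left _ hBA⟩)
    · exact Or.inr (Or.inr ⟨B, List.mem_append_left _ hB, i, h⟩)

namespace Provable

open Formula

variable {A B C : Formula} {i : ℕ}

theorem ax (h : IsAxiom A) : Provable A := ⟨[A], ⟨Or.inl h, trivial⟩, rfl⟩

theorem mp (hAB : Provable (imp A B)) (hA : Provable A) : Provable B := by
  obtain ⟨l, hl, hl'⟩ := hAB
  obtain ⟨m, hm, hm'⟩ := hA
  refine ⟨B :: (l ++ m), ⟨Or.inr (Or.inl ⟨A, ?_, ?_⟩), hl.append hm⟩, rfl⟩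
  · exact List.mem_append_right _ (List.mem_of_mem_head? (hm' ▸ rfl))
  · exact List.mem_append_left _ (List.mem_of_mem_head? (hl' ▸ rfl))

theorem gen (i : ℕ) (hA : Provable A) : Provable (all i A) := by
  obtain ⟨l, hl, hl'⟩ := hA
  exact ⟨all i A :: l, ⟨Or.inr (Or.inr ⟨A, List.mem_of_mem_head? (hl' ▸ rfl), i, rfl⟩), hl⟩, rfl⟩

theorem weaken (A : Formula) (hB : Provable B) : Provable (imp A B) := mp (ax (.a1 B A)) hB

/-- Modus ponens under a hypothesis `C`. Used repeatedly, it takes the place of the deduction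
theorem. -/
theorem mp₂ (hAB : Provable (imp C (imp A B))) (hA : Provable (imp C A)) :
    Provable (imp C B) := mp (mp (ax (.a2 C A B)) hAB) hA

theorem imp_refl (A : Formula) : Provable (imp A A) :=
  mp₂ (ax (.a1 A (imp A A))) (ax (.a1 A A))

theorem imp_trans (hAB : Provable (imp A B)) (hBC : Provable (imp B C)) : Provable (imp A C) :=
  mp₂ (weaken A hBC) hAB

/-- Proof by contradiction. -/
theorem of_neg_imp (h₁ : Provable (imp (neg B) (neg A))) (h₂ : Provable (imp (neg B) A)) :
    Provable B := mp (mp (ax (.a3 A B)) h₁) h₂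

theorem neg_neg_imp (A : Formula) : Provable (imp (neg (neg A)) A) :=
  mp₂ (imp_trans (ax (.a1 (neg (neg A)) (neg A))) (ax (.a3 (neg A) A))) (weaken _ (imp_refl _))

theorem explosion (hA : Provable (neg A)) (B : Formula) : Provable (imp A B) :=
  mp₂ (imp_trans (weaken A (weaken (neg B) hA)) (ax (.a3 A B))) (ax (.a1 A (neg B)))

/-- Reductio: a formula that implies a refutable one is refutable. -/
theorem neg_of_imp (hAB : Provable (imp A B)) (hB : Provable (neg B)) : Provable (neg A) :=
  of_neg_imp (weaken _ hB) (imp_trans (neg_neg_imp A) hAB)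

theorem neg_imp_of (hA : Provable A) (hB : Provable (neg B)) : Provable (neg (imp A B)) :=
  neg_of_imp (mp₂ (imp_refl (imp A B)) (weaken _ hA)) hB

theorem neg_neg_of (hA : Provable A) : Provable (neg (neg A)) :=
  of_neg_imp (neg_neg_imp (neg A)) (weaken _ hA)

theorem inst (hA : Provable (all i A)) {t : Term} (h : A.FreeFor t i) : Provable (A.subst i t) :=
  mp (ax (.a4 i A t h)) hA

end Provable

/-! ### Arithmetic in PA -/

namespace Term

theorem subst_var_self (i : ℕ) (t : Term) : Term.subst i (var i) t = t := by
  induction t with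
  | var j => by_cases h : j = i <;> simp [subst, h]
  | zero => rfl
  | succ t ih => simp only [subst, ih]
  | add t u iht ihu => simp only [subst, iht, ihu]
  | mul t u iht ihu => simp only [subst, iht, ihu]

theorem subst_subst (i : ℕ) (s r t : Term) :
    Term.subst i r (Term.subst i s t) = Term.subst i (Term.subst i r s) t := by
  induction t with
  | var j => by_cases h : j = i <;> simp [subst, h]
  | zero => rfl
  | succ t ih => simp only [subst, ih]
  | add t u iht ihu => simp only [subst, iht, ihu]
  | mul t u iht ihu => simp only [subst, iht, ihu]

/-- The `j`-fold successor of a term. -/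
def succs (t : Term) : ℕ → Term
  | 0 => t
  | j + 1 => succ (t.succs j)

theorem subst_succs (i : ℕ) (s t : Term) (j : ℕ) :
    Term.subst i s (t.succs j) = (Term.subst i s t).succs j := by
  induction j with
  | zero => rfl
  | succ j ih => simp only [succs, subst, ih]

theorem succs_zero (j : ℕ) : zero.succs j = numeral j := by
  induction j with
  | zero => rfl
  | succ j ih => simp only [succs, numeral, ih]

theorem succs_succ (t : Term) (j : ℕ) : t.succ.succs j = t.succs (j + 1) := by
  induction j with
  | zero => rfl
  | succ j ih => rw [succs, ih]; rfl

/-- The variables of the axioms do not occur in the term. -/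
def Fresh (t : Term) : Prop := ∀ i < 4, ¬ t.Occurs i

theorem Fresh.numeral (n : ℕ) : (numeral n).Fresh := fun i _ => not_occurs_numeral i n

theorem Fresh.var {i : ℕ} (h : 4 ≤ i) : (var i).Fresh := fun j hj e => by
  have : i = j := e
  omega

theorem Fresh.succ {t : Term} (h : t.Fresh) : t.succ.Fresh := h

theorem Fresh.add {t u : Term} (ht : t.Fresh) (hu : u.Fresh) : (t.add u).Fresh :=
  fun i hi e => e.elim (ht i hi) (hu i hi)

theorem Fresh.mul {t u : Term} (ht : t.Fresh) (hu : u.Fresh) : (t.mul u).Fresh :=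
  fun i hi e => e.elim (ht i hi) (hu i hi)

theorem Fresh.subst_eq {t : Term} (h : t.Fresh) {i : ℕ} (hi : i < 4) (s : Term) :
    Term.subst i s t = t := subst_eq_self (h i hi)

end Term

namespace Formula

theorem subst_var_self (i : ℕ) (A : Formula) : A.subst i (.var i) = A := by
  induction A with
  | eq t u => simp only [subst, Term.subst_var_self]
  | neg A ih => simp only [subst, ih]
  | imp A B ihA ihB => simp only [subst, ihA, ihB]
  | all j A ih => simp only [subst, ih, ite_self]

theorem subst_subst (i : ℕ) (s r : Term) (A : Formula) :
    (A.subst i s).subst i r = A.subst i (Term.subst i r s) := by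
  induction A with
  | eq t u => simp only [subst, Term.subst_subst]
  | neg A ih => simp only [subst, ih]
  | imp A B ihA ihB => simp only [subst, ihA, ihB]
  | all j A ih =>
    by_cases h : j = i
    · simp only [subst, if_pos h]
    · simp only [subst, if_neg h, ih]

end Formula

namespace Provable

open Formula Term

variable {r s t u : Term}

/-- The variables 1, 2, 3 of the axiom are instantiated one after the other, so a term inserted
early must not contain a variable that is replaced later. This is the purpose of `Fresh`; the term
inserted last may be arbitrary. -/
theorem eq_imp_eq_imp_eq (hr : r.Fresh) (hs : s.Fresh) (t : Term) :
    Provable (imp (eq r s) (imp (eq r t) (eq s t))) := by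
  have h₁ := inst (gen 1 (ax .s1)) (t := r) ⟨trivial, trivial, trivial⟩
  have h₂ := inst (gen 2 h₁) (t := s) ⟨trivial, trivial, trivial⟩
  have h₃ := inst (gen 3 h₂) (t := t) ⟨trivial, trivial, trivial⟩
  simpa [Formula.subst, Term.subst, hr.subst_eq, hs.subst_eq] using h₃

theorem eq_imp_succ_eq (hr : r.Fresh) (s : Term) :
    Provable (imp (eq r s) (eq (succ r) (succ s))) := by
  have h₁ := inst (gen 1 (ax .s2)) (t := r) ⟨trivial, trivial⟩
  have h₂ := inst (gen 2 h₁) (t := s) ⟨trivial, trivial⟩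
  simpa [Formula.subst, Term.subst, hr.subst_eq] using h₂

theorem neg_zero_eq_succ (r : Term) : Provable (neg (eq zero (succ r))) :=
  inst (gen 1 (ax .s3)) (t := r) trivial

theorem succ_eq_imp_eq (hr : r.Fresh) (s : Term) :
    Provable (imp (eq (succ r) (succ s)) (eq r s)) := by
  have h₁ := inst (gen 1 (ax .s4)) (t := r) ⟨trivial, trivial⟩
  have h₂ := inst (gen 2 h₁) (t := s) ⟨trivial, trivial⟩
  simpa [Formula.subst, Term.subst, hr.subst_eq] using h₂

theorem add_zero (r : Term) : Provable (eq (add r zero) r) :=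
  inst (gen 1 (ax .s5)) (t := r) trivial

theorem add_succ (hr : r.Fresh) (s : Term) :
    Provable (eq (add r (succ s)) (succ (add r s))) := by
  have h₁ := inst (gen 1 (ax .s6)) (t := r) trivial
  have h₂ := inst (gen 2 h₁) (t := s) trivial
  simpa [Formula.subst, Term.subst, hr.subst_eq] using h₂

theorem mul_zero (r : Term) : Provable (eq (mul r zero) zero) :=
  inst (gen 1 (ax .s7)) (t := r) trivial

theorem mul_succ (hr : r.Fresh) (s : Term) :
    Provable (eq (mul r (succ s)) (add (mul r s) r)) := by
  have h₁ := inst (gen 1 (ax .s8)) (t := r) trivial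
  have h₂ := inst (gen 2 h₁) (t := s) trivial
  simpa [Formula.subst, Term.subst, hr.subst_eq] using h₂

theorem eq_of_eq_of_eq (hr : r.Fresh) (hs : s.Fresh) (hrs : Provable (eq r s))
    (hrt : Provable (eq r t)) : Provable (eq s t) :=
  mp (mp (eq_imp_eq_imp_eq hr hs _) hrs) hrt

/-- Reflexivity is not an axiom of S; it comes from `s1` applied twice to `r + 0 = r`. -/
theorem eq_refl (hr : r.Fresh) : Provable (eq r r) :=
  eq_of_eq_of_eq (hr.add (Fresh.numeral 0)) hr (add_zero r) (add_zero r)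

theorem eq_symm (hr : r.Fresh) (hs : s.Fresh) (h : Provable (eq r s)) : Provable (eq s r) :=
  eq_of_eq_of_eq hr hs h (eq_refl hr)

theorem eq_trans (hr : r.Fresh) (hs : s.Fresh) (hrs : Provable (eq r s))
    (hst : Provable (eq s t)) : Provable (eq r t) :=
  eq_of_eq_of_eq hs hr (eq_symm hr hs hrs) hst

theorem neg_succ_eq_zero (hr : r.Fresh) : Provable (neg (eq (succ r) zero)) :=
  neg_of_imp (mp₂ (eq_imp_eq_imp_eq hr.succ (Fresh.numeral 0) _)
    (weaken _ (eq_refl hr.succ))) (neg_zero_eq_succ r)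

theorem add_succ_eq_imp (hr : r.Fresh) (hs : s.Fresh) (t : Term) :
    Provable (imp (eq (add r (succ s)) t) (eq (succ (add r s)) t)) :=
  mp (eq_imp_eq_imp_eq (hr.add hs.succ) (hr.add hs).succ t) (add_succ hr s)

/-- Congruence of addition is needed only for a numeral as second summand, in `numeral_mul`, so
induction on `n` outside PA suffices. -/
theorem eq_add_numeral (hr : r.Fresh) (hs : s.Fresh) (h : Provable (eq r s)) (n : ℕ) :
    Provable (eq (add r (numeral n)) (add s (numeral n))) := by
  induction n with
  | zero =>
    exact eq_trans (hr.add (.numeral 0)) hr (add_zero r)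
      (eq_trans hr hs h (eq_symm (hs.add (.numeral 0)) hs (add_zero s)))
  | succ n ih =>
    have hrn := hr.add (.numeral n)
    have hsn := hs.add (.numeral n)
    exact eq_trans (hr.add (.numeral (n + 1))) hrn.succ (add_succ hr _)
      (eq_trans hrn.succ hsn.succ (mp (eq_imp_succ_eq hrn _) ih)
        (eq_symm (hs.add (.numeral (n + 1))) hsn.succ (add_succ hs _)))

theorem numeral_add (m n : ℕ) :
    Provable (eq (add (numeral m) (numeral n)) (numeral (m + n))) := by
  induction n with
  | zero => exact add_zero _
  | succ n ih =>
    have h := (Fresh.numeral m).add (.numeral n)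
    exact eq_trans ((Fresh.numeral m).add (.numeral (n + 1))) h.succ (add_succ (.numeral m) _)
      (mp (eq_imp_succ_eq h _) ih)

theorem numeral_mul (m n : ℕ) :
    Provable (eq (mul (numeral m) (numeral n)) (numeral (m * n))) := by
  induction n with
  | zero => exact mul_zero _
  | succ n ih =>
    have h := (Fresh.numeral m).mul (.numeral n)
    exact eq_trans ((Fresh.numeral m).mul (.numeral (n + 1))) (h.add (.numeral m))
      (mul_succ (.numeral m) _) (eq_trans (h.add (.numeral m))
        ((Fresh.numeral (m * n)).add (.numeral m)) (eq_add_numeral h (.numeral _) ih m)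
        (numeral_add _ _))

theorem neg_numeral_eq {m n : ℕ} (h : m ≠ n) : Provable (neg (eq (numeral m) (numeral n))) := by
  induction m generalizing n with
  | zero =>
    cases n with
    | zero => exact absurd rfl h
    | succ n => exact neg_zero_eq_succ _
  | succ m ih =>
    cases n with
    | zero => exact neg_succ_eq_zero (.numeral m)
    | succ n =>
      exact neg_of_imp (succ_eq_imp_eq (.numeral m) _) (ih fun e => h (e ▸ rfl))

theorem neg_eq_numeral (ht : t.Fresh) {m n : ℕ} (h : Provable (eq t (numeral m)))
    (hmn : m ≠ n) : Provable (neg (eq t (numeral n))) :=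
  neg_of_imp (mp (eq_imp_eq_imp_eq ht (.numeral m) _) h) (neg_numeral_eq hmn)

/-- A formula all of whose instances up to `k` are provable holds provably below `k`. -/
theorem add_eq_numeral_imp {x z : ℕ} (hx : 4 ≤ x) (hz : 4 ≤ z) (hxz : z ≠ x) (A : Formula)
    (k j : ℕ) (h : ∀ m ≤ k, Provable (A.subst x (numeral (m + j)))) :
    Provable (imp (eq (add (var z) (var x)) (numeral k)) (A.subst x ((var x).succs j))) := by
  -- The offset `j` must vary: passing from `x` to its successor lowers `k` by one and raises `j` by
  -- one.
  induction k generalizing j with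
  | zero =>
    -- Induction inside PA serves only to distinguish zero from successors; `weaken` discards its
    -- induction hypothesis. For `k = 0` the successor case is vacuous, since `z + S x = 0` is
    -- refutable.
    have hs := mp (mp (ax (.s9 x (imp (eq (add (var z) (var x)) (numeral 0))
      (A.subst x ((var x).succs j))))) ?_) (gen x (weaken _ ?_))
    · simpa only [Formula.subst_var_self] using
        inst hs (freeFor_of_occurs (s := var x) (fun j (h : x = j) => h.symm) _)
    · simp only [Formula.subst, Term.subst, if_neg hxz, if_true, Formula.subst_subst,
        subst_succs, succs_zero, numeral_subst]
      exact weaken _ (by simpa using h 0 le_rfl)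
    · simp only [Formula.subst, Term.subst, if_neg hxz, if_true, numeral_subst]
      exact explosion (neg_of_imp (add_succ_eq_imp (.var hz) (.var hx) _)
        (neg_succ_eq_zero ((Fresh.var hz).add (.var hx)))) _
  | succ k ih =>
    have hs := mp (mp (ax (.s9 x (imp (eq (add (var z) (var x)) (numeral (k + 1)))
      (A.subst x ((var x).succs j))))) ?_) (gen x (weaken _ ?_))
    · simpa only [Formula.subst_var_self] using
        inst hs (freeFor_of_occurs (s := var x) (fun j (h : x = j) => h.symm) _)
    · simp only [Formula.subst, Term.subst, if_neg hxz, if_true, Formula.subst_subst,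
        subst_succs, succs_zero, numeral_subst]
      exact weaken _ (by simpa using h 0 (Nat.zero_le _))
    · simp only [Formula.subst, Term.subst, if_neg hxz, if_true, numeral_subst,
        Formula.subst_subst, subst_succs, succs_succ]
      -- From `z + S x = k + 1` PA derives `z + x = k`, to which the outer induction hypothesis
      -- applies.
      refine imp_trans (imp_trans (add_succ_eq_imp (.var hz) (.var hx) _)
        (succ_eq_imp_eq ((Fresh.var hz).add (.var hx)) _)) (ih (j + 1) fun m hm => ?_)
      have := h (m + 1) (Nat.succ_le_succ hm)
      rwa [Nat.add_right_comm m 1 j] at this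

end Provable

/-! ### Bounded formulas -/

/-- The sequence with first term `x`, followed by `v`. -/
def push {α : Type*} (x : α) (v : ℕ → α) : ℕ → α
  | 0 => x
  | n + 1 => v n

theorem comp_push {α β : Type*} (f : α → β) (x : α) (v : ℕ → α) :
    (fun k => f (push x v k)) = push (f x) fun k => f (v k) := by
  funext k; cases k <;> rfl

/-- Formulas with bounded quantifiers only. The variables are de Bruijn indices. -/
inductive Bdd : Type
  | add (a b c : ℕ)
  | mul (a b c : ℕ)
  | neg (φ : Bdd)
  | imp (φ ψ : Bdd)
  | ball (b : ℕ) (φ : Bdd)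

namespace Bdd

open Term

/-- Satisfaction in the natural numbers. -/
def Eval : (ℕ → ℕ) → Bdd → Prop
  | v, add a b c => v a + v b = v c
  | v, mul a b c => v a * v b = v c
  | v, neg φ => ¬ φ.Eval v
  | v, imp φ ψ => φ.Eval v → ψ.Eval v
  | v, ball b φ => ∀ x ≤ v b, φ.Eval (push x v)

/-- The translation into PA, with the terms `ρ` for the free variables and with bound variables
from `N` on. -/
def toFormula : (ℕ → Term) → ℕ → Bdd → Formula
  | ρ, _, add a b c => .eq (.add (ρ a) (ρ b)) (ρ c)
  | ρ, _, mul a b c => .eq (.mul (ρ a) (ρ b)) (ρ c)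
  | ρ, N, neg φ => .neg (φ.toFormula ρ N)
  | ρ, N, imp φ ψ => .imp (φ.toFormula ρ N) (ψ.toFormula ρ N)
  -- The bound `x ≤ b` is rendered by a second universal variable `z` with `z + x = b`. Two fresh
  -- variables are consumed, hence `N + 2`.
  | ρ, N, ball b φ => .all N (.all (N + 1) (.imp (.eq (.add (var (N + 1)) (var N)) (ρ b))
      (φ.toFormula (push (var N) ρ) (N + 2))))

/-- All bound variables are at least `N`, so substitution for `i < N` reaches only the parameters.
As a literal identity of formulas it needs no capture condition on `s`. -/
theorem toFormula_subst (φ : Bdd) {i N : ℕ} (h : i < N) (s : Term) (ρ : ℕ → Term) :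
    (φ.toFormula ρ N).subst i s = φ.toFormula (fun k => Term.subst i s (ρ k)) N := by
  induction φ generalizing N ρ with
  | add a b c => rfl
  | mul a b c => rfl
  | neg φ ih => simp only [toFormula, Formula.subst, ih h]
  | imp φ ψ ihφ ihψ => simp only [toFormula, Formula.subst, ihφ h, ihψ h]
  | ball b φ ih =>
    have h₁ : N ≠ i := by omega
    have h₂ : N + 1 ≠ i := by omega
    simp only [toFormula, Formula.subst, Term.subst, if_neg h₁, if_neg h₂,
      ih (show i < N + 2 by omega), comp_push]

theorem free_toFormula (φ : Bdd) {i N : ℕ} {ρ : ℕ → Term} (h : (φ.toFormula ρ N).Free i) :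
    ∃ k, (ρ k).Occurs i := by
  induction φ generalizing N ρ with
  | add a b c => rcases h with (h | h) | h <;> exact ⟨_, h⟩
  | mul a b c => rcases h with (h | h) | h <;> exact ⟨_, h⟩
  | neg φ ih => exact ih h
  | imp φ ψ ihφ ihψ => exact h.elim ihφ ihψ
  | ball b φ ih =>
    obtain ⟨h₁, h₂, h⟩ := h
    rcases h with ((h | h) | h) | h
    · exact absurd h h₂
    · exact absurd h h₁
    · exact ⟨_, h⟩
    · obtain ⟨_ | k, hk⟩ := ih h
      · exact absurd hk h₁
      · exact ⟨k, hk⟩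

/-- Bounded formulas are decided by PA according to their truth value. -/
theorem provable_toFormula (φ : Bdd) {N : ℕ} (hN : 4 ≤ N) (v : ℕ → ℕ) :
    (φ.Eval v → Provable (φ.toFormula (fun k => numeral (v k)) N)) ∧
    (¬ φ.Eval v → Provable (.neg (φ.toFormula (fun k => numeral (v k)) N))) := by
  induction φ generalizing N v with
  | add a b c =>
    have h := Provable.numeral_add (v a) (v b)
    exact ⟨fun e => by rwa [show v a + v b = v c from e] at h,
      Provable.neg_eq_numeral ((Fresh.numeral _).add (.numeral _)) h⟩
  | mul a b c =>
    have h := Provable.numeral_mul (v a) (v b)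
    exact ⟨fun e => by rwa [show v a * v b = v c from e] at h,
      Provable.neg_eq_numeral ((Fresh.numeral _).mul (.numeral _)) h⟩
  | neg φ ih => exact ⟨(ih hN v).2, fun h => ((ih hN v).1 (not_not.1 h)).neg_neg_of⟩
  | imp φ ψ ihφ ihψ =>
    constructor
    · intro h
      by_cases hφ : φ.Eval v
      · exact Provable.weaken _ ((ihψ hN v).1 (h hφ))
      · exact Provable.explosion ((ihφ hN v).2 hφ) _
    · intro h
      obtain ⟨h₁, h₂⟩ := Classical.not_imp.1 h
      exact Provable.neg_imp_of ((ihφ hN v).1 h₁) ((ihψ hN v).2 h₂)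
  | ball b φ ih =>
    have hsub (m : ℕ) : (φ.toFormula (push (var N) fun k => numeral (v k)) (N + 2)).subst N
        (numeral m) = φ.toFormula (fun k => numeral (push m v k)) (N + 2) := by
      rw [toFormula_subst φ (by omega), comp_push, comp_push]
      simp only [numeral_subst, Term.subst, if_true]
    constructor
    · intro h
      refine Provable.gen _ (Provable.gen _ ?_)
      have := Provable.add_eq_numeral_imp hN (show 4 ≤ N + 1 by omega) (by omega)
        (φ.toFormula (push (var N) fun k => numeral (v k)) (N + 2)) (v b) 0 fun m hm => by
          rw [hsub]; exact (ih (by omega) (push m v)).1 (h m hm)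
      rwa [succs, Formula.subst_var_self] at this
    · intro h
      obtain ⟨m, hm, h⟩ : ∃ m ≤ v b, ¬ φ.Eval (push m v) := by simpa [Eval] using h
      have h₁ := Provable.ax (.a4 N (.all (N + 1) (.imp (.eq (.add (var (N + 1)) (var N))
        (numeral (v b))) (φ.toFormula (push (var N) fun k => numeral (v k)) (N + 2))))
        (numeral m) (Formula.freeFor_numeral _ _ _))
      -- The counterexample `m ≤ v b` is paired with `z = v b - m`, which makes the premise `z + m =
      -- v b` provable.
      have h₂ := Provable.ax (.a4 (N + 1) (.imp (.eq (.add (var (N + 1)) (numeral m))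
        (numeral (v b))) (φ.toFormula (fun k => numeral (push m v k)) (N + 2)))
        (numeral (v b - m)) (Formula.freeFor_numeral _ _ _))
      simp only [Formula.subst, Term.subst, hsub, numeral_subst, if_true,
        if_neg (show N + 1 ≠ N by omega)] at h₁
      rw [Formula.subst, toFormula_subst φ (by omega)] at h₂
      simp only [Formula.subst, Term.subst, numeral_subst, if_true] at h₂
      refine Provable.neg_of_imp (Provable.imp_trans h₁ h₂) (Provable.neg_imp_of ?_
        ((ih (by omega) (push m v)).2 h))
      have := Provable.numeral_add (v b - m) m
      rwa [Nat.sub_add_cancel hm] at this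

end Bdd

/-! ### Relations defined by bounded formulas -/

namespace Bdd

/-- The renaming of the variables under a quantifier. -/
def lift (σ : ℕ → ℕ) : ℕ → ℕ := push 0 fun k => σ k + 1

/-- Renaming of variables. -/
def rename : (ℕ → ℕ) → Bdd → Bdd
  | σ, add a b c => add (σ a) (σ b) (σ c)
  | σ, mul a b c => mul (σ a) (σ b) (σ c)
  | σ, neg φ => neg (φ.rename σ)
  | σ, imp φ ψ => imp (φ.rename σ) (ψ.rename σ)
  | σ, ball b φ => ball (σ b) (φ.rename (lift σ))

theorem push_lift (x : ℕ) (v : ℕ → ℕ) (σ : ℕ → ℕ) :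
    (fun k => push x v (lift σ k)) = push x fun k => v (σ k) := by
  funext k; cases k <;> rfl

theorem eval_rename (φ : Bdd) (σ v : ℕ → ℕ) :
    (φ.rename σ).Eval v ↔ φ.Eval fun k => v (σ k) := by
  induction φ generalizing σ v with
  | add a b c => rfl
  | mul a b c => rfl
  | neg φ ih => simp only [rename, Eval, ih]
  | imp φ ψ ihφ ihψ => simp only [rename, Eval, ihφ, ihψ]
  | ball b φ ih => simp only [rename, Eval, ih, push_lift]

open Primrec in
-- The environment is a finite list padded with zeros, so that it can be the input of a primitive
-- recursive predicate. A bounded quantifier ranges over the members of a `List.range`.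
theorem primrecPred_eval (φ : Bdd) : PrimrecPred fun l : List ℕ => φ.Eval fun k => l.getD k 0 := by
  have hget (k : ℕ) : Primrec fun l : List ℕ => l.getD k 0 :=
    (list_getD 0).comp .id (.const k)
  induction φ with
  | add a b c => exact Primrec.eq.comp (nat_add.comp (hget a) (hget b)) (hget c)
  | mul a b c => exact Primrec.eq.comp (nat_mul.comp (hget a) (hget b)) (hget c)
  | neg φ ih => exact ih.not
  | imp φ ψ ihφ ihψ =>
    exact (ihφ.not.or ihψ).of_eq fun l => imp_iff_not_or.symm
  | ball b φ ih =>
    have h : PrimrecRel fun (x : ℕ) (l : List ℕ) => φ.Eval fun k => (x :: l).getD k 0 :=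
      ih.comp (list_cons.comp fst snd)
    refine (h.forall_mem_list.comp (list_range.comp (succ.comp (hget b))) .id).of_eq fun l => ?_
    simp only [List.mem_range, Eval, id, Nat.lt_succ_iff]
    refine forall₂_congr fun x _ => ?_
    rw [show (fun k => (x :: l).getD k 0) = push x fun k => l.getD k 0 by
      funext k; cases k <;> rfl]

end Bdd

/-- The relation is defined by a bounded formula. -/
def IsBounded (R : (ℕ → ℕ) → Prop) : Prop := ∃ φ : Bdd, ∀ v, φ.Eval v ↔ R v

namespace IsBounded

variable {R S : (ℕ → ℕ) → Prop}

theorem of_iff (h : IsBounded R) (hRS : ∀ v, R v ↔ S v) : IsBounded S :=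
  h.imp fun _ hφ v => (hφ v).trans (hRS v)

theorem add (a b c : ℕ) : IsBounded fun v => v a + v b = v c := ⟨.add a b c, fun _ => Iff.rfl⟩

theorem mul (a b c : ℕ) : IsBounded fun v => v a * v b = v c := ⟨.mul a b c, fun _ => Iff.rfl⟩

theorem rename (h : IsBounded R) (σ : ℕ → ℕ) : IsBounded fun v => R fun k => v (σ k) := by
  obtain ⟨φ, hφ⟩ := h
  exact ⟨φ.rename σ, fun v => (φ.eval_rename σ v).trans (hφ _)⟩

theorem not (h : IsBounded R) : IsBounded fun v => ¬ R v := by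
  obtain ⟨φ, hφ⟩ := h
  exact ⟨.neg φ, fun v => not_congr (hφ v)⟩

theorem imp (hR : IsBounded R) (hS : IsBounded S) : IsBounded fun v => R v → S v := by
  obtain ⟨φ, hφ⟩ := hR
  obtain ⟨ψ, hψ⟩ := hS
  exact ⟨.imp φ ψ, fun v => imp_congr (hφ v) (hψ v)⟩

theorem and (hR : IsBounded R) (hS : IsBounded S) : IsBounded fun v => R v ∧ S v :=
  (hR.imp hS.not).not.of_iff fun v => by tauto

theorem or (hR : IsBounded R) (hS : IsBounded S) : IsBounded fun v => R v ∨ S v :=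
  (hR.not.imp hS).of_iff fun v => by tauto

theorem ball (hR : IsBounded R) (b : ℕ) : IsBounded fun v => ∀ x ≤ v b, R (push x v) := by
  obtain ⟨φ, hφ⟩ := hR
  exact ⟨.ball b φ, fun v => forall₂_congr fun x _ => hφ _⟩

theorem bex (hR : IsBounded R) (b : ℕ) : IsBounded fun v => ∃ x ≤ v b, R (push x v) :=
  (hR.not.ball b).not.of_iff fun v => by simp

/-- The only atoms are graphs of sum and product, so a zero is first produced as a solution of `x +
x = x`, and equality is read as `v a + 0 = v b`. -/
theorem eq (a b : ℕ) : IsBounded fun v => v a = v b :=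
  (((add 0 0 0).and (add (a + 1) 0 (b + 1))).bex b).of_iff fun v => by
    constructor
    · rintro ⟨x, -, h₁, h₂⟩
      change x + x = x at h₁
      change v a + x = v b at h₂
      omega
    · intro h
      exact ⟨0, Nat.zero_le _, rfl, h⟩

theorem le (a b : ℕ) : IsBounded fun v => v a ≤ v b :=
  ((eq 0 (a + 1)).bex b).of_iff fun v =>
    ⟨fun ⟨_, h, e⟩ => (show _ = v a from e) ▸ h, fun h => ⟨v a, h, rfl⟩⟩

theorem lt (a b : ℕ) : IsBounded fun v => v a < v b := (le b a).not.of_iff fun _ => Nat.not_le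

theorem eq_zero (a : ℕ) : IsBounded fun v => v a = 0 := (add a a a).of_iff fun v => by omega

theorem eq_one (a : ℕ) : IsBounded fun v => v a = 1 :=
  ((mul a a a).and (eq_zero a).not).of_iff fun v => by
    constructor
    · rintro ⟨h₁, h₂⟩
      exact Nat.eq_of_mul_eq_mul_left (Nat.pos_of_ne_zero h₂) (h₁.trans (mul_one _).symm)
    · intro h; simp [h]

end IsBounded

/-! ### Relations defined by an unbounded existential quantifier -/

/-- The relation is defined by a bounded formula preceded by an existential quantifier. -/
def IsSigma (R : (ℕ → ℕ) → Prop) : Prop := ∃ S, IsBounded S ∧ ∀ v, R v ↔ ∃ y, S (push y v)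

namespace IsSigma

variable {R S : (ℕ → ℕ) → Prop}

theorem of_iff (h : IsSigma R) (hRS : ∀ v, S v ↔ R v) : IsSigma S := by
  obtain ⟨R', h, h'⟩ := h
  exact ⟨R', h, fun v => (hRS v).trans (h' v)⟩

theorem of_isBounded (h : IsBounded R) : IsSigma R :=
  ⟨_, h.rename Nat.succ, fun _ => ⟨fun h => ⟨0, h⟩, fun ⟨_, h⟩ => h⟩⟩

theorem rename (h : IsSigma R) (σ : ℕ → ℕ) : IsSigma fun v => R fun k => v (σ k) := by
  obtain ⟨R', h, h'⟩ := h
  refine ⟨_, h.rename (Bdd.lift σ), fun v => (h' _).trans ?_⟩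
  simp only [Bdd.push_lift]

/-- Two unbounded quantifiers merge into one: the new variable is a common bound for both witnesses.
-/
theorem ex (h : IsSigma R) : IsSigma fun v => ∃ x, R (push x v) := by
  obtain ⟨R', h, h'⟩ := h
  -- The renaming skips index 2, which holds the common bound and does not occur in the matrix.
  refine ⟨_, ((h.rename (push 0 (push 1 fun k => k + 3))).bex 1).bex 0, fun v => ?_⟩
  have e (x y z : ℕ) : (fun k => push x (push y (push z v)) ((push 0 (push 1 fun k => k + 3)) k)) =
      push x (push y v) := by funext k; rcases k with _ | _ | k <;> rfl
  simp only [e, h']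
  constructor
  · rintro ⟨x, y, hxy⟩
    exact ⟨max x y, x, le_max_left x y, y, le_max_right x y, hxy⟩
  · rintro ⟨-, x, -, y, -, hxy⟩
    exact ⟨x, y, hxy⟩

theorem and (hR : IsSigma R) (hS : IsSigma S) : IsSigma fun v => R v ∧ S v := by
  obtain ⟨R', hR, hR'⟩ := hR
  obtain ⟨S', hS, hS'⟩ := hS
  have h : IsSigma fun v => ∃ x, ∃ y, R' (push x v) ∧ S' (push y v) := by
    refine ex (R := fun w => ∃ y, R' (push (w 0) fun k => w (k + 1)) ∧
      S' (push y fun k => w (k + 1))) (ex (R := fun w => R' (push (w 1) fun k => w (k + 2)) ∧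
      S' (push (w 0) fun k => w (k + 2))) (of_isBounded ?_))
    refine ((hR.rename (push 1 fun k => k + 2)).and
      (hS.rename (push 0 fun k => k + 2))).of_iff fun w => ?_
    rw [comp_push, comp_push]
  exact h.of_iff fun v => by simp [hR', hS']

theorem or (hR : IsSigma R) (hS : IsSigma S) : IsSigma fun v => R v ∨ S v := by
  obtain ⟨R', hR, hR'⟩ := hR
  obtain ⟨S', hS, hS'⟩ := hS
  exact ⟨_, hR.or hS, fun v => by simp only [hR', hS', exists_or]⟩

/-- Collection: the finitely many witnesses for `x ≤ v b` have a common bound, which lets the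
unbounded quantifier move to the front. -/
theorem ball (h : IsSigma R) (b : ℕ) : IsSigma fun v => ∀ x ≤ v b, R (push x v) := by
  obtain ⟨R', h, h'⟩ := h
  refine ⟨_, ((h.rename (push 0 (push 1 fun k => k + 3))).bex 1).ball (b + 1), fun v => ?_⟩
  have e (x y z : ℕ) : (fun k => push x (push y (push z v)) ((push 0 (push 1 fun k => k + 3)) k)) =
      push x (push y v) := by funext k; rcases k with _ | _ | k <;> rfl
  simp only [e, h']
  constructor
  · intro H
    choose f hf using H
    refine ⟨((Finset.range (v b + 1)).attach.sup fun x =>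
      f x.1 (Nat.lt_succ_iff.1 (Finset.mem_range.1 x.2))), fun x hx => ⟨f x hx, ?_, hf x hx⟩⟩
    exact Finset.le_sup (f := fun x : {x // x ∈ Finset.range (v b + 1)} =>
      f x.1 (Nat.lt_succ_iff.1 (Finset.mem_range.1 x.2)))
      (Finset.mem_attach _ ⟨x, Finset.mem_range.2 (Nat.lt_succ_iff.2 hx)⟩)
  · rintro ⟨_, H⟩ x hx
    obtain ⟨y, -, hy⟩ := H x hx
    exact ⟨y, hy⟩

end IsSigma

/-- The graph of the function is defined by a bounded formula preceded by an existential
quantifier. -/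
def IsSigmaFun (f : (ℕ → ℕ) → ℕ) : Prop := IsSigma fun v => f (fun k => v (k + 1)) = v 0

theorem IsSigmaFun.rename {f : (ℕ → ℕ) → ℕ} (h : IsSigmaFun f) (σ : ℕ → ℕ) :
    IsSigmaFun fun v => f fun k => v (σ k) :=
  IsSigma.rename h (Bdd.lift σ)

theorem IsSigmaFun.proj (k : ℕ) : IsSigmaFun fun v => v k := .of_isBounded (.eq (k + 1) 0)

/-- Composition goes through graphs: intermediate values are quantified existentially, one at a
time. -/
theorem IsSigma.comp₃ {P : ℕ → ℕ → ℕ → Prop} (hP : IsSigma fun v => P (v 0) (v 1) (v 2))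
    {f g h : (ℕ → ℕ) → ℕ} (hf : IsSigmaFun f) (hg : IsSigmaFun g) (hh : IsSigmaFun h) :
    IsSigma fun v => P (f v) (g v) (h v) := by
  have H : IsSigma fun v => ∃ x, f v = x ∧ ∃ y, g v = y ∧ ∃ z, h v = z ∧ P x y z := by
    refine ex (R := fun w => f (fun k => w (k + 1)) = w 0 ∧ ∃ y, g (fun k => w (k + 1)) = y ∧
      ∃ z, h (fun k => w (k + 1)) = z ∧ P (w 0) y z) (and hf ?_)
    refine ex (R := fun w => g (fun k => w (k + 2)) = w 0 ∧
      ∃ z, h (fun k => w (k + 2)) = z ∧ P (w 1) (w 0) z) (and (hg.rename Nat.succ) ?_)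
    refine ex (R := fun w => h (fun k => w (k + 3)) = w 0 ∧ P (w 2) (w 1) (w 0))
      (and (hh.rename fun k => k + 2) ?_)
    -- The value quantified last has index 0, so the three arguments appear in reverse order.
    exact hP.rename fun k => 2 - k
  exact H.of_iff fun v => by simp

theorem IsSigma.comp₂ {P : ℕ → ℕ → Prop} (hP : IsSigma fun v => P (v 0) (v 1))
    {f g : (ℕ → ℕ) → ℕ} (hf : IsSigmaFun f) (hg : IsSigmaFun g) :
    IsSigma fun v => P (f v) (g v) :=
  IsSigma.comp₃ (P := fun x y _ => P x y) hP hf hg hg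

theorem IsSigmaFun.comp₂ {F : ℕ → ℕ → ℕ} (hF : IsSigma fun v => F (v 0) (v 1) = v 2)
    {f g : (ℕ → ℕ) → ℕ} (hf : IsSigmaFun f) (hg : IsSigmaFun g) :
    IsSigmaFun fun v => F (f v) (g v) :=
  IsSigma.comp₃ (P := fun x y z => F x y = z) hF (hf.rename Nat.succ) (hg.rename Nat.succ)
    (.proj 0)

theorem IsSigma.eq {f g : (ℕ → ℕ) → ℕ} (hf : IsSigmaFun f) (hg : IsSigmaFun g) :
    IsSigma fun v => f v = g v := .comp₂ (P := fun x y => x = y) (.of_isBounded (.eq 0 1)) hf hg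

theorem IsSigma.lt {f g : (ℕ → ℕ) → ℕ} (hf : IsSigmaFun f) (hg : IsSigmaFun g) :
    IsSigma fun v => f v < g v := .comp₂ (P := fun x y => x < y) (.of_isBounded (.lt 0 1)) hf hg

theorem IsSigma.le {f g : (ℕ → ℕ) → ℕ} (hf : IsSigmaFun f) (hg : IsSigmaFun g) :
    IsSigma fun v => f v ≤ g v := .comp₂ (P := fun x y => x ≤ y) (.of_isBounded (.le 0 1)) hf hg

/-- The value `b` of `f` is named by an existential quantifier; the disjunct `b ≤ x` exempts the
endpoint of the non-strict range. -/
theorem IsSigma.ball_lt {R : (ℕ → ℕ) → Prop} (hR : IsSigma R) {f : (ℕ → ℕ) → ℕ}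
    (hf : IsSigmaFun f) : IsSigma fun v => ∀ x < f v, R (push x v) := by
  have H : IsSigma fun v => ∃ b, f v = b ∧ ∀ x ≤ b, b ≤ x ∨ R (push x v) := by
    refine ex (R := fun w => f (fun k => w (k + 1)) = w 0 ∧
      ∀ x ≤ w 0, w 0 ≤ x ∨ R (push x fun k => w (k + 1))) (and hf ?_)
    refine IsSigma.ball (R := fun w => w 1 ≤ w 0 ∨ R (push (w 0) fun k => w (k + 2))) (or
      (le (.proj 1) (.proj 0)) ?_) 0
    refine (hR.rename (push 0 fun k => k + 2)).of_iff fun w => ?_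
    rw [comp_push]
  refine H.of_iff fun v => ?_
  simp only [exists_eq_left']
  refine forall_congr' fun x => ?_
  constructor
  · intro h _
    exact (Nat.lt_or_ge x (f v)).elim (fun hx => Or.inr (h hx)) Or.inl
  · intro h hx
    exact (h hx.le).resolve_left (Nat.not_le.2 hx)

namespace IsSigmaFun

variable {f g : (ℕ → ℕ) → ℕ}

theorem add (hf : IsSigmaFun f) (hg : IsSigmaFun g) : IsSigmaFun fun v => f v + g v :=
  comp₂ (F := fun x y => x + y) (.of_isBounded (.add 0 1 2)) hf hg

theorem mul (hf : IsSigmaFun f) (hg : IsSigmaFun g) : IsSigmaFun fun v => f v * g v :=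
  comp₂ (F := fun x y => x * y) (.of_isBounded (.mul 0 1 2)) hf hg

theorem zero : IsSigmaFun fun _ => 0 :=
  (IsSigma.of_isBounded (.eq_zero 0)).of_iff fun _ => eq_comm

theorem one : IsSigmaFun fun _ => 1 :=
  (IsSigma.of_isBounded (.eq_one 0)).of_iff fun _ => eq_comm

theorem pair (hf : IsSigmaFun f) (hg : IsSigmaFun g) : IsSigmaFun fun v => Nat.pair (f v) (g v) := by
  refine comp₂ (F := Nat.pair) ?_ hf hg
  have p := proj
  refine (((IsSigma.lt (p 0) (p 1)).and (.eq (((p 1).mul (p 1)).add (p 0)) (p 2))).or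
    ((IsSigma.le (p 1) (p 0)).and
      (.eq ((((p 0).mul (p 0)).add (p 0)).add (p 1)) (p 2)))).of_iff fun v => ?_
  unfold Nat.pair
  split_ifs with h
  · simp [h]
  · simp [h, Nat.not_lt.1 h]

theorem mod_succ (hf : IsSigmaFun f) (hg : IsSigmaFun g) :
    IsSigmaFun fun v => f v % (g v + 1) := by
  refine comp₂ (F := fun x y => x % (y + 1)) ?_ hf hg
  have p := proj
  have H : IsSigma fun v => ∃ q, q * (v 1 + 1) + v 2 = v 0 ∧ v 2 < v 1 + 1 :=
    IsSigma.ex (R := fun w => w 0 * (w 2 + 1) + w 3 = w 1 ∧ w 3 < w 2 + 1)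
      ((IsSigma.eq (((p 0).mul ((p 2).add one)).add (p 3)) (p 1)).and
        (.lt (p 3) ((p 2).add one)))
  refine H.of_iff fun v => ?_
  constructor
  · intro h
    exact ⟨v 0 / (v 1 + 1), h ▸ Nat.div_add_mod' _ _, h ▸ Nat.mod_lt _ (Nat.succ_pos _)⟩
  · rintro ⟨q, h₁, h₂⟩
    rw [← h₁, add_comm, Nat.add_mul_mod_self_right, Nat.mod_eq_of_lt h₂]

theorem unpair_fst (hf : IsSigmaFun f) : IsSigmaFun fun v => (f v).unpair.1 := by
  have p := proj
  have H : IsSigma fun v => ∃ b, Nat.pair (v 0) b = f (fun k => v (k + 1)) :=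
    IsSigma.ex (R := fun w => Nat.pair (w 1) (w 0) = f (fun k => w (k + 2)))
      (.eq ((p 1).pair (p 0)) (hf.rename fun k => k + 2))
  refine H.of_iff fun v => ⟨fun h => ⟨(f fun k => v (k + 1)).unpair.2, ?_⟩, ?_⟩
  · rw [← h, Nat.pair_unpair]
  · rintro ⟨b, h⟩
    beta_reduce
    rw [← h, Nat.unpair_pair]

theorem unpair_snd (hf : IsSigmaFun f) : IsSigmaFun fun v => (f v).unpair.2 := by
  have p := proj
  have H : IsSigma fun v => ∃ b, Nat.pair b (v 0) = f (fun k => v (k + 1)) :=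
    IsSigma.ex (R := fun w => Nat.pair (w 0) (w 1) = f (fun k => w (k + 2)))
      (.eq ((p 0).pair (p 1)) (hf.rename fun k => k + 2))
  refine H.of_iff fun v => ⟨fun h => ⟨(f fun k => v (k + 1)).unpair.1, ?_⟩, ?_⟩
  · rw [← h, Nat.pair_unpair]
  · rintro ⟨b, h⟩
    beta_reduce
    rw [← h, Nat.unpair_pair]

theorem beta (hf : IsSigmaFun f) (hg : IsSigmaFun g) :
    IsSigmaFun fun v => Nat.beta (f v) (g v) :=
  hf.unpair_fst.mod_succ ((hg.add one).mul hf.unpair_snd)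

end IsSigmaFun

/-! ### Partial recursive functions have definable graphs -/

theorem exists_beta_eq (c : ℕ → ℕ) (n : ℕ) : ∃ s, ∀ i ≤ n, Nat.beta s i = c i := by
  refine ⟨Nat.unbeta ((List.range (n + 1)).map c), fun i hi => ?_⟩
  have h := Nat.beta_unbeta_coe ((List.range (n + 1)).map c) ⟨i, by simp; omega⟩
  simpa using h

/-- Gödel's device: a single number `s`, read through `Nat.beta`, codes all values of the recursion
up to `n`. Recursion thereby becomes one existential and one bounded universal quantifier. -/
theorem mem_rec_iff_beta (p : Part ℕ) (g : ℕ → ℕ → Part ℕ) (n m : ℕ) :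
    (m ∈ (n.rec p fun y IH => IH.bind fun i => g y i : Part ℕ)) ↔
    ∃ s, Nat.beta s 0 ∈ p ∧ (∀ i < n, Nat.beta s (i + 1) ∈ g i (Nat.beta s i)) ∧
      m = Nat.beta s n := by
  constructor
  · intro h
    obtain ⟨c, hc₀, hc, rfl⟩ : ∃ c : ℕ → ℕ, c 0 ∈ p ∧ (∀ i < n, c (i + 1) ∈ g i (c i)) ∧
        m = c n := by
      induction n generalizing m with
      | zero => exact ⟨fun _ => m, h, by simp, rfl⟩
      | succ n ih =>
        obtain ⟨k, hk, hm⟩ := Part.mem_bind_iff.1 h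
        obtain ⟨c, hc₀, hc, rfl⟩ := ih k hk
        refine ⟨Function.update c (n + 1) m, by simpa using hc₀, fun i hi => ?_, by simp⟩
        rcases Nat.lt_succ_iff_lt_or_eq.1 hi with hi | rfl
        · rw [Function.update_of_ne (by omega), Function.update_of_ne (by omega)]
          exact hc i hi
        · simpa using hm
    obtain ⟨s, hs⟩ := exists_beta_eq c n
    refine ⟨s, hs 0 (Nat.zero_le _) ▸ hc₀, fun i hi => ?_, (hs n le_rfl).symm⟩
    rw [hs (i + 1) hi, hs i hi.le]
    exact hc i hi
  · rintro ⟨s, h₀, h, rfl⟩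
    induction n with
    | zero => exact h₀
    | succ n ih =>
      exact Part.mem_bind_iff.2 ⟨_, ih fun i hi => h i (hi.trans n.lt_succ_self),
        h n n.lt_succ_self⟩

/-- Induction on the generation of `f`, with input `v 0` and output `v 1`. Primitive recursion
relies on the β-function; minimization asks that all earlier values be defined and positive. -/
theorem isSigma_of_partrec {f : ℕ →. ℕ} (hf : Nat.Partrec f) :
    IsSigma fun v => v 1 ∈ f (v 0) := by
  have p := IsSigmaFun.proj
  induction hf with
  | zero => exact (IsSigma.eq (p 1) .zero).of_iff fun v => Part.mem_some_iff
  | succ => exact (IsSigma.eq (p 1) ((p 0).add .one)).of_iff fun v => Part.mem_some_iff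
  | left => exact (IsSigma.eq (p 1) (p 0).unpair_fst).of_iff fun v => Part.mem_some_iff
  | right => exact (IsSigma.eq (p 1) (p 0).unpair_snd).of_iff fun v => Part.mem_some_iff
  | @pair f g _ _ hf hg =>
    have H : IsSigma fun v => ∃ x, ∃ y, (x ∈ f (v 0) ∧ y ∈ g (v 0)) ∧ v 1 = Nat.pair x y :=
      .ex (R := fun w => ∃ y, (w 0 ∈ f (w 1) ∧ y ∈ g (w 1)) ∧ w 2 = Nat.pair (w 0) y)
        (.ex (R := fun w => (w 1 ∈ f (w 2) ∧ w 0 ∈ g (w 2)) ∧ w 3 = Nat.pair (w 1) (w 0))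
        ((IsSigma.and (.comp₂ (P := fun x y => y ∈ f x) hf (p 2) (p 1))
          (.comp₂ (P := fun x y => y ∈ g x) hg (p 2) (p 0))).and
          (.eq (p 3) ((p 1).pair (p 0)))))
    refine H.of_iff fun v => ?_
    simp [Seq.seq, eq_comm, and_assoc]
  | @comp f g _ _ hf hg =>
    have H : IsSigma fun v => ∃ x, x ∈ g (v 0) ∧ v 1 ∈ f x :=
      .ex (R := fun w => w 0 ∈ g (w 1) ∧ w 2 ∈ f (w 0))
        ((IsSigma.comp₂ (P := fun x y => y ∈ g x) hg (p 1) (p 0)).and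
          (.comp₂ (P := fun x y => y ∈ f x) hf (p 0) (p 2)))
    exact H.of_iff fun v => Part.mem_bind_iff
  | @prec f g _ _ hf hg =>
    have H : IsSigma fun v => ∃ s, Nat.beta s 0 ∈ f (v 0).unpair.1 ∧
        (∀ i < (v 0).unpair.2, Nat.beta s (i + 1) ∈
          g (Nat.pair (v 0).unpair.1 (Nat.pair i (Nat.beta s i)))) ∧
        v 1 = Nat.beta s (v 0).unpair.2 := by
      refine .ex (R := fun w => Nat.beta (w 0) 0 ∈ f (w 1).unpair.1 ∧
        (∀ i < (w 1).unpair.2, Nat.beta (w 0) (i + 1) ∈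
          g (Nat.pair (w 1).unpair.1 (Nat.pair i (Nat.beta (w 0) i)))) ∧
        w 2 = Nat.beta (w 0) (w 1).unpair.2) (IsSigma.and ?_ (IsSigma.and ?_ ?_))
      · exact .comp₂ (P := fun x y => y ∈ f x) hf (p 1).unpair_fst ((p 0).beta .zero)
      · exact .ball_lt (R := fun w => Nat.beta (w 1) (w 0 + 1) ∈
          g (Nat.pair (w 2).unpair.1 (Nat.pair (w 0) (Nat.beta (w 1) (w 0)))))
          (.comp₂ (P := fun x y => y ∈ g x) hg
            ((p 2).unpair_fst.pair ((p 0).pair ((p 1).beta (p 0)))) ((p 1).beta ((p 0).add .one)))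
          (p 1).unpair_snd
      · exact .eq (p 2) ((p 0).beta (p 1).unpair_snd)
    exact H.of_iff fun v => mem_rec_iff_beta _ (fun y i =>
      g (Nat.pair (v 0).unpair.1 (Nat.pair y i))) _ _
  | @rfind f _ hf =>
    have H : IsSigma fun v => 0 ∈ f (Nat.pair (v 0) (v 1)) ∧
        ∀ k < v 1, ∃ w, w ∈ f (Nat.pair (v 0) k) ∧ 0 < w :=
      IsSigma.and (.comp₂ (P := fun x y => y ∈ f x) hf ((p 0).pair (p 1)) .zero)
        (.ball_lt (R := fun w => ∃ x, x ∈ f (Nat.pair (w 1) (w 0)) ∧ 0 < x)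
          (.ex (R := fun w => w 0 ∈ f (Nat.pair (w 2) (w 1)) ∧ 0 < w 0)
            (.and (.comp₂ (P := fun x y => y ∈ f x) hf ((p 2).pair (p 1)) (p 0))
              (.lt .zero (p 0)))) (p 1))
    refine H.of_iff fun v => Nat.mem_rfind.trans ?_
    simp [Nat.pos_iff_ne_zero]

/-! ### Representation of recursively enumerable sets in PA -/

/-- A recursively enumerable set is the projection of a recursive relation that is expressible
in PA. -/
theorem exists_expresses_of_rePred {p : ℕ → Prop} (hp : REPred p) :
    ∃ (G : ℕ → ℕ → ℕ) (H : Formula), Computable₂ G ∧ (∀ a, p a ↔ ∃ y, G a y = 0) ∧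
      Expresses H fun x y => ¬ G x y = 0 := by
  obtain ⟨f, hf, hfp⟩ : ∃ f : ℕ →. ℕ, Nat.Partrec f ∧ ∀ a, p a ↔ ∃ m, m ∈ f a :=
    ⟨_, Partrec.nat_iff.1 (Partrec.map hp (Computable.const 0).to₂), fun a => by simp⟩
  -- The quantifier over the value of `f` and the one in the definition of its graph merge into a
  -- single `y`; what is left is the bounded formula `φ`.
  obtain ⟨S, ⟨φ, hφ⟩, hS⟩ := IsSigma.ex (R := fun w => w 0 ∈ f (w 1))
    (IsSigma.comp₂ (P := fun x y => y ∈ f x) (isSigma_of_partrec hf) (.proj 1) (.proj 0))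
  let env (a y : ℕ) : ℕ → ℕ := push y (push a fun _ => 0)
  have hφp (a : ℕ) : p a ↔ ∃ y, φ.Eval (env a y) := by
    have := hS (push a fun _ => 0)
    simp only [← hφ] at this
    rw [← this]
    exact hfp a
  have hdec : PrimrecPred fun q : ℕ × ℕ => φ.Eval (env q.1 q.2) := by
    refine (φ.primrecPred_eval.comp (Primrec.list_cons.comp .snd
      (Primrec.list_cons.comp .fst (.const [])))).of_eq fun q => ?_
    rw [show (fun k => [q.2, q.1].getD k 0) = env q.1 q.2 by
      funext k; rcases k with _ | _ | k <;> rfl]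
  classical
  -- In `φ` the index 0 is the witness `y` and the index 1 the input `a`, whereas `Expresses` wants
  -- the input as `var 0` and the witness as `var 1`.
  let ρ : ℕ → Term := push (.var 1) (push (.var 0) fun _ => .zero)
  have hρ (m n : ℕ) : (((φ.toFormula ρ 4).neg.subst 0 (.numeral m)).subst 1 (.numeral n)) =
      (φ.toFormula (fun k => .numeral (env m n k)) 4).neg := by
    simp only [Formula.subst, φ.toFormula_subst (show 0 < 4 by omega),
      φ.toFormula_subst (show 1 < 4 by omega)]
    congr 2
    funext k
    rcases k with _ | _ | k
    · simp [ρ, env, push, Term.subst]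
    · simp [ρ, env, push, Term.subst]
    · rfl
  refine ⟨fun a y => if φ.Eval (env a y) then 0 else 1, (φ.toFormula ρ 4).neg,
    (Primrec.ite hdec (.const 0) (.const 1)).to_comp, fun a => by simp [hφp], fun i hi => ?_,
    fun m n => ?_⟩
  · obtain ⟨k, hk⟩ := φ.free_toFormula hi
    rcases k with _ | _ | k
    · exact Or.inr (Eq.symm hk)
    · exact Or.inl (Eq.symm hk)
    · exact hk.elim
  · obtain ⟨h₁, h₂⟩ := φ.provable_toFormula (le_refl 4) (env m n)
    rw [hρ]
    simp only [ite_eq_left_iff, one_ne_zero, imp_false, not_not]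
    exact ⟨h₂, fun h => (h₁ h).neg_neg_of⟩

/-! ### Recursion on Gödel numbers -/

section CodeRec

variable {α σ : Type*}

/-- Recursion on numbers `Nat.pair t x` with tag `t` and content `x`. The value at tag `0` is given
by `base`. For other tags the function `step` may use the values at `x` and at its two
components. -/
def codeRec (base : ℕ → σ) (step : ℕ × ℕ × σ × σ × σ → σ) (n : ℕ) : σ :=
  if h : n.unpair.1 = 0 then base n.unpair.2
  else
    have h₀ : n.unpair.2 < n := by
      have := Nat.unpair_add_le n
      omega
    have h₁ : n.unpair.2.unpair.1 < n := (Nat.unpair_left_le _).trans_lt h₀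
    have h₂ : n.unpair.2.unpair.2 < n := (Nat.unpair_right_le _).trans_lt h₀
    step (n.unpair.1, n.unpair.2, codeRec base step n.unpair.2,
      codeRec base step n.unpair.2.unpair.1, codeRec base step n.unpair.2.unpair.2)
termination_by n

theorem codeRec_zero (base : ℕ → σ) (step : ℕ × ℕ × σ × σ × σ → σ) (x : ℕ) :
    codeRec base step (Nat.pair 0 x) = base x := by
  rw [codeRec]; simp

theorem codeRec_succ (base : ℕ → σ) (step : ℕ × ℕ × σ × σ × σ → σ) {t : ℕ} (ht : t ≠ 0) (x : ℕ) :
    codeRec base step (Nat.pair t x) = step (t, x, codeRec base step x,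
      codeRec base step x.unpair.1, codeRec base step x.unpair.2) := by
  rw [codeRec]; simp [ht]

variable [Primcodable α] [Primcodable σ]

open Primrec in
-- Course-of-values recursion: `l` lists the values at all smaller numbers and its length is the
-- current argument. A nonzero tag makes the content and both its components smaller, so the lookups
-- in `l` succeed.
theorem primrec_codeRec {base : α → ℕ → σ} {step : α → ℕ × ℕ × σ × σ × σ → σ}
    (hb : Primrec₂ base) (hs : Primrec₂ step) :
    Primrec₂ fun a n => codeRec (base a) (step a) n := by
  let g (a : α) (l : List σ) : Option σ :=
    if l.length.unpair.1 = 0 then some (base a l.length.unpair.2)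
    else l[l.length.unpair.2]?.bind fun r => l[l.length.unpair.2.unpair.1]?.bind fun r₁ =>
      l[l.length.unpair.2.unpair.2]?.map fun r₂ =>
        step a (l.length.unpair.1, l.length.unpair.2, r, r₁, r₂)
  have ht : Primrec fun l : List σ => l.length.unpair.1 := fst.comp (unpair.comp list_length)
  have hx : Primrec fun l : List σ => l.length.unpair.2 := snd.comp (unpair.comp list_length)
  have hx₁ : Primrec fun l : List σ => l.length.unpair.2.unpair.1 := fst.comp (unpair.comp hx)
  have hx₂ : Primrec fun l : List σ => l.length.unpair.2.unpair.2 := snd.comp (unpair.comp hx)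
  have hg : Primrec₂ g := by
    refine Primrec.ite (Primrec.eq.comp (ht.comp snd) (const 0))
      (option_some.comp (hb.comp fst (hx.comp snd)))
      (option_bind (list_getElem?.comp snd (hx.comp snd)) ?_)
    refine option_bind (list_getElem?.comp (snd.comp fst) (hx₁.comp (snd.comp fst))) ?_
    refine option_map (list_getElem?.comp (snd.comp (fst.comp fst))
      (hx₂.comp (snd.comp (fst.comp fst)))) ?_
    have hl : Primrec fun q : (((α × List σ) × σ) × σ) × σ => q.1.1.1.2 :=
      snd.comp (fst.comp (fst.comp fst))
    exact hs.comp (fst.comp (fst.comp (fst.comp fst)))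
      ((ht.comp hl).pair ((hx.comp hl).pair ((snd.comp (fst.comp fst)).pair
        ((snd.comp fst).pair snd))))
  refine nat_strong_rec _ hg fun a n => ?_
  have h (f : ℕ → σ) (k : ℕ) (hk : k < n) : ((List.range n).map f)[k]? = some (f k) := by
    simp [hk]
  rw [codeRec]
  by_cases hn : n.unpair.1 = 0
  · simp [g, hn]
  · have h₀ : n.unpair.2 < n := by
      have := Nat.unpair_add_le n
      omega
    simp only [g, List.length_map, List.length_range, if_neg hn, dif_neg hn, h _ _ h₀,
      h _ _ ((Nat.unpair_left_le _).trans_lt h₀), h _ _ ((Nat.unpair_right_le _).trans_lt h₀),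
      Option.bind_some, Option.map_some]

theorem primrec_codeRec_const {base : ℕ → σ} {step : ℕ × ℕ × σ × σ × σ → σ}
    (hb : Primrec base) (hs : Primrec step) : Primrec (codeRec base step) :=
  (primrec_codeRec (α := Unit) (base := fun _ => base) (step := fun _ => step)
    (hb.comp .snd) (hs.comp .snd)).comp (.const ()) .id

end CodeRec

/-! ### Syntactic operations on Gödel numbers -/

namespace Term

theorem code_injective : Function.Injective code := by
  intro t
  induction t with
  | var i => intro u h; cases u <;> simp [code] at h ⊢; exact h
  | zero => intro u h; cases u <;> simp [code] at h ⊢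
  | succ t ih => intro u h; cases u <;> simp [code] at h ⊢; exact ih h
  | add t u iht ihu =>
    intro u h; cases u <;> simp [code] at h ⊢; exact ⟨iht h.1, ihu h.2⟩
  | mul t u iht ihu =>
    intro u h; cases u <;> simp [code] at h ⊢; exact ⟨iht h.1, ihu h.2⟩

/-- The number is the Gödel number of a term. -/
def isCode (n : ℕ) : Bool :=
  codeRec (fun _ => true) (fun p =>
    if p.1 = 1 then decide (p.2.1 = 0)
    else if p.1 = 2 then p.2.2.1
    else if p.1 = 3 ∨ p.1 = 4 then p.2.2.2.1 && p.2.2.2.2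
    else false) n

theorem isCode_iff (n : ℕ) : isCode n = true ↔ ∃ t : Term, t.code = n := by
  constructor
  · induction n using Nat.strong_induction_on with
    | _ n ih =>
      intro h
      obtain ⟨t, x, rfl⟩ : ∃ t x, n = Nat.pair t x := ⟨_, _, (Nat.pair_unpair n).symm⟩
      rcases Nat.eq_zero_or_pos t with rfl | ht
      · exact ⟨var x, rfl⟩
      have h₀ : x < Nat.pair t x := by
        have := Nat.add_le_pair t x
        omega
      have h₁ := (Nat.unpair_left_le x).trans_lt h₀
      have h₂ := (Nat.unpair_right_le x).trans_lt h₀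
      rw [isCode, codeRec_succ _ _ ht.ne'] at h
      dsimp only at h
      split_ifs at h with h1 h2 h3
      · exact ⟨zero, by subst h1; simp at h; simp [code, h]⟩
      · obtain ⟨u, rfl⟩ := ih _ h₀ h
        exact ⟨succ u, by simp [code, h2]⟩
      · rw [Bool.and_eq_true] at h
        obtain ⟨u, hu⟩ := ih _ h₁ h.1
        obtain ⟨w, hw⟩ := ih _ h₂ h.2
        rcases h3 with rfl | rfl
        · exact ⟨add u w, by simp [code, hu, hw]⟩
        · exact ⟨mul u w, by simp [code, hu, hw]⟩
  · rintro ⟨t, rfl⟩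
    induction t with
    | var i => rw [isCode, code, codeRec_zero]
    | zero => rw [isCode, code, codeRec_succ _ _ (by omega)]; simp
    | succ t ih => rw [isCode, code, codeRec_succ _ _ (by omega)]; simpa [isCode] using ih
    | add t u iht ihu =>
      rw [isCode, code, codeRec_succ _ _ (by omega)]; simpa [isCode] using And.intro iht ihu
    | mul t u iht ihu =>
      rw [isCode, code, codeRec_succ _ _ (by omega)]; simpa [isCode] using And.intro iht ihu

/-- Substitution of the term with Gödel number `p.2` for the variable `p.1`. -/
def substCode (p : ℕ × ℕ) (n : ℕ) : ℕ :=
  codeRec (fun x => if x = p.1 then p.2 else Nat.pair 0 x) (fun q =>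
    if q.1 = 1 then Nat.pair 1 q.2.1
    else if q.1 = 2 then Nat.pair 2 q.2.2.1
    else Nat.pair q.1 (Nat.pair q.2.2.2.1 q.2.2.2.2)) n

theorem substCode_code (i : ℕ) (s t : Term) :
    substCode (i, s.code) t.code = (Term.subst i s t).code := by
  induction t with
  | var j => rw [substCode, code, codeRec_zero]; simp only [subst]; split_ifs <;> rfl
  | zero => rw [substCode, code, codeRec_succ _ _ (by omega)]; rfl
  | succ t ih =>
    rw [substCode, code, codeRec_succ _ _ (by omega)]
    simpa [substCode, subst, code] using ih
  | add t u iht ihu =>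
    rw [substCode, code, codeRec_succ _ _ (by omega)]
    simpa [substCode, subst, code] using ⟨iht, ihu⟩
  | mul t u iht ihu =>
    rw [substCode, code, codeRec_succ _ _ (by omega)]
    simpa [substCode, subst, code] using ⟨iht, ihu⟩

/-- Reduces the occurrence test to substitution, so that no separate recursion on codes is needed
for it. -/
theorem subst_zero_eq_self_iff (i : ℕ) (t : Term) : Term.subst i zero t = t ↔ ¬ t.Occurs i := by
  refine ⟨fun h => ?_, subst_eq_self⟩
  induction t with
  | var j =>
    intro e
    simp [subst, show j = i from e] at h
  | zero => exact id
  | succ t ih => exact ih (by simpa [subst] using h)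
  | add t u iht ihu =>
    simp only [subst, add.injEq] at h
    exact fun e => e.elim (iht h.1) (ihu h.2)
  | mul t u iht ihu =>
    simp only [subst, mul.injEq] at h
    exact fun e => e.elim (iht h.1) (ihu h.2)

theorem substCode_eq_self_iff (i : ℕ) (t : Term) :
    substCode (i, zero.code) t.code = t.code ↔ ¬ t.Occurs i := by
  rw [substCode_code, code_injective.eq_iff, subst_zero_eq_self_iff]

theorem code_le_code_subst {i : ℕ} (s : Term) {t : Term} (h : t.Occurs i) :
    s.code ≤ (Term.subst i s t).code := by
  induction t with
  | var j => rw [subst, if_pos (show j = i from h)]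
  | zero => exact h.elim
  | succ t ih => exact (ih h).trans (Nat.right_le_pair _ _)
  | add t u iht ihu =>
    refine le_trans ?_ (Nat.right_le_pair _ _)
    exact h.elim (fun h => (iht h).trans (Nat.left_le_pair _ _))
      fun h => (ihu h).trans (Nat.right_le_pair _ _)
  | mul t u iht ihu =>
    refine le_trans ?_ (Nat.right_le_pair _ _)
    exact h.elim (fun h => (iht h).trans (Nat.left_le_pair _ _))
      fun h => (ihu h).trans (Nat.right_le_pair _ _)

end Term

namespace Formula

theorem code_injective : Function.Injective code := by
  intro A
  induction A with
  | eq t u =>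
    intro B h; cases B <;> simp [code] at h ⊢
    exact ⟨Term.code_injective h.1, Term.code_injective h.2⟩
  | neg A ih => intro B h; cases B <;> simp [code] at h ⊢; exact ih h
  | imp A B ihA ihB =>
    intro B h; cases B <;> simp [code] at h ⊢; exact ⟨ihA h.1, ihB h.2⟩
  | all i A ih => intro B h; cases B <;> simp [code] at h ⊢; exact ⟨h.1, ih h.2⟩

/-- The number is the Gödel number of a formula. -/
def isCode (n : ℕ) : Bool :=
  codeRec (fun x => Term.isCode x.unpair.1 && Term.isCode x.unpair.2) (fun p =>
    if p.1 = 1 then p.2.2.1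
    else if p.1 = 2 then p.2.2.2.1 && p.2.2.2.2
    else if p.1 = 3 then p.2.2.2.2
    else false) n

theorem isCode_iff (n : ℕ) : isCode n = true ↔ ∃ A : Formula, A.code = n := by
  constructor
  · induction n using Nat.strong_induction_on with
    | _ n ih =>
      intro h
      obtain ⟨t, x, rfl⟩ : ∃ t x, n = Nat.pair t x := ⟨_, _, (Nat.pair_unpair n).symm⟩
      rcases Nat.eq_zero_or_pos t with rfl | ht
      · rw [isCode, codeRec_zero, Bool.and_eq_true, Term.isCode_iff, Term.isCode_iff] at h
        obtain ⟨⟨t, ht⟩, ⟨u, hu⟩⟩ := h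
        exact ⟨eq t u, by simp [code, ht, hu]⟩
      have h₀ : x < Nat.pair t x := by
        have := Nat.add_le_pair t x
        omega
      have h₁ := (Nat.unpair_left_le x).trans_lt h₀
      have h₂ := (Nat.unpair_right_le x).trans_lt h₀
      rw [isCode, codeRec_succ _ _ ht.ne'] at h
      dsimp only at h
      split_ifs at h with h1 h2 h3
      · obtain ⟨A, rfl⟩ := ih _ h₀ h
        exact ⟨neg A, by simp [code, h1]⟩
      · rw [Bool.and_eq_true] at h
        obtain ⟨A, hA⟩ := ih _ h₁ h.1
        obtain ⟨B, hB⟩ := ih _ h₂ h.2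
        exact ⟨imp A B, by simp [code, hA, hB, h2]⟩
      · obtain ⟨A, hA⟩ := ih _ h₂ h
        exact ⟨all x.unpair.1 A, by simp [code, hA, h3]⟩
  · rintro ⟨A, rfl⟩
    induction A with
    | eq t u =>
      rw [isCode, code, codeRec_zero, Bool.and_eq_true, Term.isCode_iff, Term.isCode_iff]
      simp
    | neg A ih => rw [isCode, code, codeRec_succ _ _ (by omega)]; simpa [isCode] using ih
    | imp A B ihA ihB =>
      rw [isCode, code, codeRec_succ _ _ (by omega)]; simpa [isCode] using And.intro ihA ihB
    | all i A ih => rw [isCode, code, codeRec_succ _ _ (by omega)]; simpa [isCode] using ih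

/-- Substitution of the term with Gödel number `p.2` for the variable `p.1`. -/
def substCode (p : ℕ × ℕ) (n : ℕ) : ℕ :=
  codeRec (fun x => Nat.pair 0
      (Nat.pair (Term.substCode p x.unpair.1) (Term.substCode p x.unpair.2))) (fun q =>
    if q.1 = 1 then Nat.pair 1 q.2.2.1
    else if q.1 = 2 then Nat.pair 2 (Nat.pair q.2.2.2.1 q.2.2.2.2)
    else if q.2.1.unpair.1 = p.1 then Nat.pair q.1 q.2.1
    else Nat.pair q.1 (Nat.pair q.2.1.unpair.1 q.2.2.2.2)) n

theorem substCode_code (i : ℕ) (s : Term) (A : Formula) :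
    substCode (i, s.code) A.code = (A.subst i s).code := by
  induction A with
  | eq t u =>
    rw [substCode, code, codeRec_zero]
    simp [subst, code, Term.substCode_code]
  | neg A ih =>
    rw [substCode, code, codeRec_succ _ _ (by omega)]
    simpa [substCode, subst, code] using ih
  | imp A B ihA ihB =>
    rw [substCode, code, codeRec_succ _ _ (by omega)]
    simpa [substCode, subst, code] using ⟨ihA, ihB⟩
  | all j A ih =>
    rw [substCode, code, codeRec_succ _ _ (by omega)]
    by_cases h : j = i
    · simp [subst, h, code]
    · simpa [substCode, subst, h, code] using ih

theorem subst_zero_eq_self_iff (i : ℕ) (A : Formula) : A.subst i .zero = A ↔ ¬ A.Free i := by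
  refine ⟨fun h => ?_, subst_eq_self⟩
  induction A with
  | eq t u =>
    simp only [subst, eq.injEq, Term.subst_zero_eq_self_iff] at h
    exact fun e => e.elim h.1 h.2
  | neg A ih => exact ih (by simpa [subst] using h)
  | imp A B ihA ihB =>
    simp only [subst, imp.injEq] at h
    exact fun e => e.elim (ihA h.1) (ihB h.2)
  | all j A ih =>
    rintro ⟨hj, hA⟩
    simp only [subst, if_neg hj, all.injEq, true_and] at h
    exact ih h hA

theorem substCode_eq_self_iff (i : ℕ) (A : Formula) :
    substCode (i, Term.zero.code) A.code = A.code ↔ ¬ A.Free i := by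
  rw [substCode_code, code_injective.eq_iff, subst_zero_eq_self_iff]

theorem code_le_code_subst {i : ℕ} (s : Term) {A : Formula} (h : A.Free i) :
    s.code ≤ (A.subst i s).code := by
  induction A with
  | eq t u =>
    refine le_trans ?_ (Nat.right_le_pair _ _)
    exact h.elim (fun h => (Term.code_le_code_subst s h).trans (Nat.left_le_pair _ _))
      fun h => (Term.code_le_code_subst s h).trans (Nat.right_le_pair _ _)
  | neg A ih => exact (ih h).trans (Nat.right_le_pair _ _)
  | imp A B ihA ihB =>
    refine le_trans ?_ (Nat.right_le_pair _ _)
    exact h.elim (fun h => (ihA h).trans (Nat.left_le_pair _ _))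
      fun h => (ihB h).trans (Nat.right_le_pair _ _)
  | all j A ih =>
    rw [subst, if_neg h.1]
    exact (ih h.2).trans ((Nat.right_le_pair _ _).trans (Nat.right_le_pair _ _))

/-- The term with Gödel number `p.2` is free for the variable `p.1`. -/
def freeForCode (p : ℕ × ℕ) (n : ℕ) : Bool :=
  codeRec (fun _ => true) (fun q =>
    if q.1 = 1 then q.2.2.1
    else if q.1 = 2 then q.2.2.2.1 && q.2.2.2.2
    -- On formula codes this branch has tag 3, and `Nat.pair 3 q.2.1` is the quantified formula
    -- itself. Both freeness tests compare a code with the result of substituting `zero`.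
    else decide (substCode (p.1, Term.zero.code) (Nat.pair 3 q.2.1) = Nat.pair 3 q.2.1) ||
      (decide (Term.substCode (q.2.1.unpair.1, Term.zero.code) p.2 = p.2) && q.2.2.2.2)) n

theorem freeForCode_code (i : ℕ) (s : Term) (A : Formula) :
    freeForCode (i, s.code) A.code = true ↔ A.FreeFor s i := by
  induction A with
  | eq t u => rw [freeForCode, code, codeRec_zero]; simp [FreeFor]
  | neg A ih =>
    rw [freeForCode, code, codeRec_succ _ _ (by omega)]
    simpa [freeForCode, FreeFor] using ih
  | imp A B ihA ihB =>
    rw [freeForCode, code, codeRec_succ _ _ (by omega)]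
    simpa [freeForCode, FreeFor] using and_congr ihA ihB
  | all j A ih =>
    have h₁ := substCode_eq_self_iff i (all j A)
    have h₂ := Term.substCode_eq_self_iff j s
    rw [code] at h₁
    rw [freeForCode, code, codeRec_succ _ _ (by omega)]
    simp only [if_neg (show (3 : ℕ) ≠ 1 by omega), if_neg (show (3 : ℕ) ≠ 2 by omega),
      Bool.or_eq_true, Bool.and_eq_true, decide_eq_true_eq, Nat.unpair_pair, h₁, h₂]
    exact or_congr Iff.rfl (and_congr Iff.rfl ih)

end Formula

/-! ### Primitive recursiveness of the syntactic operations -/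

section

open Primrec

theorem primrec_termIsCode : Primrec Term.isCode := by
  refine primrec_codeRec_const (.const true) ?_
  have ht : Primrec fun q : ℕ × ℕ × Bool × Bool × Bool => q.1 := fst
  have hr : Primrec fun q : ℕ × ℕ × Bool × Bool × Bool => q.2.2 := snd.comp snd
  exact Primrec.ite (Primrec.eq.comp ht (const 1))
    (Primrec.eq.decide.comp (fst.comp snd) (const 0))
    (Primrec.ite (Primrec.eq.comp ht (const 2)) (fst.comp hr)
      (Primrec.ite ((Primrec.eq.comp ht (const 3)).or (Primrec.eq.comp ht (const 4)))
        (Primrec.and.comp (fst.comp (snd.comp hr)) (snd.comp (snd.comp hr))) (const false)))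

theorem primrec_termSubstCode : Primrec₂ Term.substCode := by
  refine primrec_codeRec (Primrec.ite (Primrec.eq.comp snd (fst.comp fst)) (snd.comp fst)
    (Primrec₂.natPair.comp (const 0) snd)) ?_
  have ht : Primrec fun q : (ℕ × ℕ) × ℕ × ℕ × ℕ × ℕ × ℕ => q.2.1 := fst.comp snd
  have hr : Primrec fun q : (ℕ × ℕ) × ℕ × ℕ × ℕ × ℕ × ℕ => q.2.2.2 := snd.comp (snd.comp snd)
  exact Primrec.ite (Primrec.eq.comp ht (const 1))
    (Primrec₂.natPair.comp (const 1) (fst.comp (snd.comp snd)))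
    (Primrec.ite (Primrec.eq.comp ht (const 2)) (Primrec₂.natPair.comp (const 2) (fst.comp hr))
      (Primrec₂.natPair.comp ht
        (Primrec₂.natPair.comp (fst.comp (snd.comp hr)) (snd.comp (snd.comp hr)))))

theorem primrec_unpair_fst : Primrec fun x : ℕ => x.unpair.1 := fst.comp unpair

theorem primrec_unpair_snd : Primrec fun x : ℕ => x.unpair.2 := snd.comp unpair

theorem primrec_formulaIsCode : Primrec Formula.isCode := by
  refine primrec_codeRec_const (Primrec.and.comp (primrec_termIsCode.comp primrec_unpair_fst)
      (primrec_termIsCode.comp primrec_unpair_snd)) ?_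
  have ht : Primrec fun q : ℕ × ℕ × Bool × Bool × Bool => q.1 := fst
  have hr : Primrec fun q : ℕ × ℕ × Bool × Bool × Bool => q.2.2 := snd.comp snd
  exact Primrec.ite (Primrec.eq.comp ht (const 1)) (fst.comp hr)
    (Primrec.ite (Primrec.eq.comp ht (const 2))
      (Primrec.and.comp (fst.comp (snd.comp hr)) (snd.comp (snd.comp hr)))
      (Primrec.ite (Primrec.eq.comp ht (const 3)) (snd.comp (snd.comp hr)) (const false)))

theorem primrec_formulaSubstCode : Primrec₂ Formula.substCode := by
  refine primrec_codeRec (Primrec₂.natPair.comp (const 0) (Primrec₂.natPair.comp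
    (primrec_termSubstCode.comp fst (primrec_unpair_fst.comp snd))
    (primrec_termSubstCode.comp fst (primrec_unpair_snd.comp snd)))) ?_
  have ht : Primrec fun q : (ℕ × ℕ) × ℕ × ℕ × ℕ × ℕ × ℕ => q.2.1 := fst.comp snd
  have hx : Primrec fun q : (ℕ × ℕ) × ℕ × ℕ × ℕ × ℕ × ℕ => q.2.2.1 := fst.comp (snd.comp snd)
  have hr : Primrec fun q : (ℕ × ℕ) × ℕ × ℕ × ℕ × ℕ × ℕ => q.2.2.2 := snd.comp (snd.comp snd)
  exact Primrec.ite (Primrec.eq.comp ht (const 1))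
    (Primrec₂.natPair.comp (const 1) (fst.comp hr))
    (Primrec.ite (Primrec.eq.comp ht (const 2))
      (Primrec₂.natPair.comp (const 2)
        (Primrec₂.natPair.comp (fst.comp (snd.comp hr)) (snd.comp (snd.comp hr))))
      (Primrec.ite (Primrec.eq.comp (primrec_unpair_fst.comp hx) (fst.comp fst))
        (Primrec₂.natPair.comp ht hx)
        (Primrec₂.natPair.comp ht
          (Primrec₂.natPair.comp (primrec_unpair_fst.comp hx) (snd.comp (snd.comp hr))))))

theorem primrec_freeForCode : Primrec₂ Formula.freeForCode := by
  refine primrec_codeRec (.const true) ?_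
  have ht : Primrec fun q : (ℕ × ℕ) × ℕ × ℕ × Bool × Bool × Bool => q.2.1 := fst.comp snd
  have hx : Primrec fun q : (ℕ × ℕ) × ℕ × ℕ × Bool × Bool × Bool => q.2.2.1 :=
    fst.comp (snd.comp snd)
  have hn : Primrec fun q : (ℕ × ℕ) × ℕ × ℕ × Bool × Bool × Bool => Nat.pair 3 q.2.2.1 :=
    Primrec₂.natPair.comp (const 3) hx
  have hr : Primrec fun q : (ℕ × ℕ) × ℕ × ℕ × Bool × Bool × Bool => q.2.2.2 :=
    snd.comp (snd.comp snd)
  exact Primrec.ite (Primrec.eq.comp ht (const 1)) (fst.comp hr)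
    (Primrec.ite (Primrec.eq.comp ht (const 2))
      (Primrec.and.comp (fst.comp (snd.comp hr)) (snd.comp (snd.comp hr)))
      (Primrec.or.comp
        (Primrec.eq.decide.comp (primrec_formulaSubstCode.comp
          ((fst.comp fst).pair (const _)) hn) hn)
        (Primrec.and.comp
          (Primrec.eq.decide.comp (primrec_termSubstCode.comp
            ((primrec_unpair_fst.comp hx).pair (const _)) (snd.comp fst)) (snd.comp fst))
          (snd.comp (snd.comp hr)))))

/-! ### The axioms and the proof relation are primitive recursive -/

/-- The Gödel number of an implication. -/
def impCode (a b : ℕ) : ℕ := Nat.pair 2 (Nat.pair a b)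

/-- The Gödel number of a negation. -/
def negCode (a : ℕ) : ℕ := Nat.pair 1 a

/-- The Gödel number of a universal formula. -/
def allCode (i a : ℕ) : ℕ := Nat.pair 3 (Nat.pair i a)

/-- The first component of the content of a Gödel number. -/
def leftCode (n : ℕ) : ℕ := n.unpair.2.unpair.1

/-- The second component of the content of a Gödel number. -/
def rightCode (n : ℕ) : ℕ := n.unpair.2.unpair.2

@[simp] theorem code_imp (A B : Formula) : (A.imp B).code = impCode A.code B.code := rfl

@[simp] theorem code_neg (A : Formula) : A.neg.code = negCode A.code := rfl

@[simp] theorem code_all (i : ℕ) (A : Formula) : (Formula.all i A).code = allCode i A.code := rfl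

@[simp] theorem leftCode_imp (a b : ℕ) : leftCode (impCode a b) = a := by
  simp [leftCode, impCode]

@[simp] theorem rightCode_imp (a b : ℕ) : rightCode (impCode a b) = b := by
  simp [rightCode, impCode]

@[simp] theorem leftCode_all (a b : ℕ) : leftCode (allCode a b) = a := by
  simp [leftCode, allCode]

@[simp] theorem rightCode_all (a b : ℕ) : rightCode (allCode a b) = b := by
  simp [rightCode, allCode]

@[simp] theorem isCode_code (A : Formula) : Formula.isCode A.code = true :=
  (Formula.isCode_iff _).2 ⟨A, rfl⟩

theorem primrec_impCode : Primrec₂ impCode :=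
  Primrec₂.natPair.comp (const 2) (Primrec₂.natPair.comp fst snd)

theorem primrec_negCode : Primrec negCode := Primrec₂.natPair.comp (const 1) .id

theorem primrec_allCode : Primrec₂ allCode :=
  Primrec₂.natPair.comp (const 3) (Primrec₂.natPair.comp fst snd)

theorem primrec_leftCode : Primrec leftCode := primrec_unpair_fst.comp primrec_unpair_snd

theorem primrec_rightCode : Primrec rightCode := primrec_unpair_snd.comp primrec_unpair_snd

theorem primrecPred_isCode {f : ℕ → ℕ} (hf : Primrec f) :
    PrimrecPred fun n => ∃ A : Formula, A.code = f n :=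
  (Primrec.eq.comp (primrec_formulaIsCode.comp hf) (const true)).of_eq fun _ =>
    Formula.isCode_iff _

section Axioms

open Formula

theorem primrecPred_a1 : PrimrecPred fun n => ∃ A B : Formula, (imp A (imp B A)).code = n := by
  have ha := primrec_leftCode
  have hb : Primrec fun n => leftCode (rightCode n) := primrec_leftCode.comp primrec_rightCode
  refine ((primrecPred_isCode ha).and ((primrecPred_isCode hb).and (Primrec.eq.comp
    (primrec_impCode.comp ha (primrec_impCode.comp hb ha)) .id))).of_eq fun n => ⟨?_, ?_⟩
  · rintro ⟨⟨A, hA⟩, ⟨B, hB⟩, h⟩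
    exact ⟨A, B, by simpa [hA, hB] using h⟩
  · rintro ⟨A, B, rfl⟩
    simp

theorem primrecPred_a2 : PrimrecPred fun n => ∃ A B C : Formula,
    (imp (imp A (imp B C)) (imp (imp A B) (imp A C))).code = n := by
  have ha : Primrec fun n => leftCode (leftCode n) := primrec_leftCode.comp primrec_leftCode
  have hr : Primrec fun n => rightCode (leftCode n) := primrec_rightCode.comp primrec_leftCode
  have hb : Primrec fun n => leftCode (rightCode (leftCode n)) := primrec_leftCode.comp hr
  have hc : Primrec fun n => rightCode (rightCode (leftCode n)) := primrec_rightCode.comp hr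
  refine ((primrecPred_isCode ha).and ((primrecPred_isCode hb).and ((primrecPred_isCode hc).and
    (Primrec.eq.comp (primrec_impCode.comp (primrec_impCode.comp ha (primrec_impCode.comp hb hc))
      (primrec_impCode.comp (primrec_impCode.comp ha hb) (primrec_impCode.comp ha hc)))
      .id)))).of_eq fun n => ⟨?_, ?_⟩
  · rintro ⟨⟨A, hA⟩, ⟨B, hB⟩, ⟨C, hC⟩, h⟩
    exact ⟨A, B, C, by simpa [hA, hB, hC] using h⟩
  · rintro ⟨A, B, C, rfl⟩
    simp

theorem primrecPred_a3 : PrimrecPred fun n => ∃ A B : Formula,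
    (imp (imp (neg B) (neg A)) (imp (imp (neg B) A) B)).code = n := by
  have ha : Primrec fun n => rightCode (leftCode (rightCode n)) :=
    primrec_rightCode.comp (primrec_leftCode.comp primrec_rightCode)
  have hb : Primrec fun n => rightCode (rightCode n) := primrec_rightCode.comp primrec_rightCode
  have hnb := primrec_negCode.comp hb
  refine ((primrecPred_isCode ha).and ((primrecPred_isCode hb).and (Primrec.eq.comp
    (primrec_impCode.comp (primrec_impCode.comp hnb (primrec_negCode.comp ha))
      (primrec_impCode.comp (primrec_impCode.comp hnb ha) hb)) .id))).of_eq fun n => ⟨?_, ?_⟩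
  · rintro ⟨⟨A, hA⟩, ⟨B, hB⟩, h⟩
    exact ⟨A, B, by simpa [hA, hB] using h⟩
  · rintro ⟨A, B, rfl⟩
    simp

/-- Bounds the search for the term in `a4`. If `i` is free in `A`, then `t` is a part of the
instance and its code is no larger; if not, `zero`, whose code is 2, does as well. Hence the 3. -/
theorem exists_code_lt (i : ℕ) (A : Formula) (t : Term) (h : A.FreeFor t i) :
    ∃ u : Term, u.code < (A.subst i t).code + 3 ∧ A.FreeFor u i ∧ A.subst i u = A.subst i t := by
  by_cases hi : A.Free i
  · exact ⟨t, by have := code_le_code_subst t hi; omega, h, rfl⟩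
  · refine ⟨.zero, ?_, freeFor_numeral A i 0, by rw [subst_eq_self hi, subst_eq_self hi]⟩
    have : Term.zero.code = 2 := by simp [Term.code, Nat.pair]
    omega

/-- The variable and the formula are read off the code; the term alone is not, and a bounded search
finds it. -/
theorem primrecPred_a4 : PrimrecPred fun n => ∃ (i : ℕ) (A : Formula) (t : Term),
    A.FreeFor t i ∧ (imp (all i A) (A.subst i t)).code = n := by
  have hi : Primrec fun n => leftCode (leftCode n) := primrec_leftCode.comp primrec_leftCode
  have ha : Primrec fun n => rightCode (leftCode n) := primrec_rightCode.comp primrec_leftCode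
  have hR : PrimrecRel fun t n : ℕ => Term.isCode t = true ∧
      freeForCode (leftCode (leftCode n), t) (rightCode (leftCode n)) = true ∧
      impCode (allCode (leftCode (leftCode n)) (rightCode (leftCode n)))
        (substCode (leftCode (leftCode n), t) (rightCode (leftCode n))) = n :=
    (Primrec.eq.comp (primrec_termIsCode.comp fst) (const true)).and
      ((Primrec.eq.comp (primrec_freeForCode.comp ((hi.comp snd).pair fst) (ha.comp snd))
        (const true)).and
      (Primrec.eq.comp (primrec_impCode.comp
        (primrec_allCode.comp (hi.comp snd) (ha.comp snd))
        (primrec_formulaSubstCode.comp ((hi.comp snd).pair fst) (ha.comp snd))) snd))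
  refine ((primrecPred_isCode ha).and
    (hR.exists_lt.comp (nat_add.comp .id (const 3)) .id)).of_eq fun n => ⟨?_, ?_⟩
  · rintro ⟨⟨A, hA⟩, t, -, ht, h₁, h₂⟩
    obtain ⟨t, rfl⟩ := (Term.isCode_iff t).1 ht
    simp only [id] at h₁ h₂
    rw [← hA, freeForCode_code] at h₁
    rw [← hA, substCode_code] at h₂
    exact ⟨_, A, t, h₁, h₂⟩
  · rintro ⟨i, A, t, h, rfl⟩
    obtain ⟨u, hu, hu₁, hu₂⟩ := exists_code_lt i A t h
    refine ⟨⟨A, by simp⟩, u.code, ?_, (Term.isCode_iff _).2 ⟨u, rfl⟩, ?_⟩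
    · have h₁ := Nat.right_le_pair A.code (A.subst i t).code
      have : (A.subst i t).code ≤ (imp (all i A) (A.subst i t)).code :=
        (Nat.right_le_pair _ _).trans (Nat.right_le_pair _ _)
      simp only [id]
      omega
    · simp [freeForCode_code, substCode_code, hu₁, hu₂]

theorem primrecPred_a5 : PrimrecPred fun n => ∃ (i : ℕ) (A B : Formula),
    ¬ A.Free i ∧ (imp (all i (imp A B)) (imp A (all i B))).code = n := by
  have hi : Primrec fun n => leftCode (leftCode n) := primrec_leftCode.comp primrec_leftCode
  have ha : Primrec fun n => leftCode (rightCode n) := primrec_leftCode.comp primrec_rightCode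
  have hb : Primrec fun n => rightCode (rightCode (rightCode n)) :=
    primrec_rightCode.comp (primrec_rightCode.comp primrec_rightCode)
  refine ((primrecPred_isCode ha).and ((primrecPred_isCode hb).and
    ((Primrec.eq.comp (primrec_formulaSubstCode.comp (hi.pair (const Term.zero.code)) ha) ha).and
    (Primrec.eq.comp (primrec_impCode.comp (primrec_allCode.comp hi (primrec_impCode.comp ha hb))
      (primrec_impCode.comp ha (primrec_allCode.comp hi hb))) .id)))).of_eq fun n => ⟨?_, ?_⟩
  · rintro ⟨⟨A, hA⟩, ⟨B, hB⟩, h₁, h₂⟩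
    rw [← hA, substCode_eq_self_iff] at h₁
    exact ⟨_, A, B, h₁, by simpa [hA, hB] using h₂⟩
  · rintro ⟨i, A, B, h, rfl⟩
    simpa [substCode_eq_self_iff] using h

theorem primrecPred_s9 : PrimrecPred fun n => ∃ (i : ℕ) (A : Formula), (imp (A.subst i .zero)
    (imp (all i (imp A (A.subst i (.succ (.var i))))) (all i A))).code = n := by
  have hr : Primrec fun n => rightCode (rightCode n) := primrec_rightCode.comp primrec_rightCode
  have hi : Primrec fun n => leftCode (rightCode (rightCode n)) := primrec_leftCode.comp hr
  have ha : Primrec fun n => rightCode (rightCode (rightCode n)) := primrec_rightCode.comp hr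
  refine ((primrecPred_isCode ha).and (Primrec.eq.comp (primrec_impCode.comp
    (primrec_formulaSubstCode.comp (hi.pair (const Term.zero.code)) ha)
    (primrec_impCode.comp (primrec_allCode.comp hi (primrec_impCode.comp ha
      (primrec_formulaSubstCode.comp (hi.pair (Primrec₂.natPair.comp (const 2)
        (Primrec₂.natPair.comp (const 0) hi))) ha))) (primrec_allCode.comp hi ha)))
    .id)).of_eq fun n => ⟨?_, ?_⟩
  · rintro ⟨⟨A, hA⟩, h⟩
    refine ⟨leftCode (rightCode (rightCode n)), A, ?_⟩
    simp only [code_imp, code_all, ← substCode_code, hA]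
    exact h
  · rintro ⟨i, A, rfl⟩
    refine ⟨⟨A, by simp⟩, ?_⟩
    simp only [code_imp, code_all, ← substCode_code, rightCode_imp, rightCode_all, leftCode_all]
    rfl

theorem primrecPred_isAxiom : PrimrecPred fun n => ∃ A : Formula, A.code = n ∧ IsAxiom A := by
  have hc (A : Formula) : PrimrecPred fun n => A.code = n := Primrec.eq.comp (const _) .id
  open Term in
  refine (primrecPred_a1.or (primrecPred_a2.or (primrecPred_a3.or (primrecPred_a4.or
    (primrecPred_a5.or (primrecPred_s9.or
    ((hc (imp (eq (var 1) (var 2)) (imp (eq (var 1) (var 3)) (eq (var 2) (var 3))))).or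
    ((hc (imp (eq (var 1) (var 2)) (eq (succ (var 1)) (succ (var 2))))).or
    ((hc (neg (eq zero (succ (var 1))))).or
    ((hc (imp (eq (succ (var 1)) (succ (var 2))) (eq (var 1) (var 2)))).or
    ((hc (eq (add (var 1) zero) (var 1))).or
    ((hc (eq (add (var 1) (succ (var 2))) (succ (add (var 1) (var 2))))).or
    ((hc (eq (mul (var 1) zero) zero)).or
    (hc (eq (mul (var 1) (succ (var 2))) (add (mul (var 1) (var 2)) (var 1)))
    )))))))))))))).of_eq fun n => ⟨?_, ?_⟩
  · rintro (⟨A, B, h⟩ | ⟨A, B, C, h⟩ | ⟨A, B, h⟩ | ⟨i, A, t, hf, h⟩ | ⟨i, A, B, hf, h⟩ |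
      ⟨i, A, h⟩ | h | h | h | h | h | h | h | h)
    exacts [⟨_, h, .a1 A B⟩, ⟨_, h, .a2 A B C⟩, ⟨_, h, .a3 A B⟩, ⟨_, h, .a4 i A t hf⟩,
      ⟨_, h, .a5 i A B hf⟩, ⟨_, h, .s9 i A⟩, ⟨_, h, .s1⟩, ⟨_, h, .s2⟩, ⟨_, h, .s3⟩, ⟨_, h, .s4⟩,
      ⟨_, h, .s5⟩, ⟨_, h, .s6⟩, ⟨_, h, .s7⟩, ⟨_, h, .s8⟩]
  · rintro ⟨A, rfl, h⟩
    cases h with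
    | a1 A B => exact .inl ⟨A, B, rfl⟩
    | a2 A B C => exact .inr (.inl ⟨A, B, C, rfl⟩)
    | a3 A B => exact .inr (.inr (.inl ⟨A, B, rfl⟩))
    | a4 i A t h => exact .inr (.inr (.inr (.inl ⟨i, A, t, h, rfl⟩)))
    | a5 i A B h => exact .inr (.inr (.inr (.inr (.inl ⟨i, A, B, h, rfl⟩))))
    | s9 i A => exact .inr (.inr (.inr (.inr (.inr (.inl ⟨i, A, rfl⟩)))))
    | _ => simp

end Axioms

/-- Justification of a formula by those of a list, in terms of Gödel numbers. -/
theorem justified_iff (l : List Formula) (A : Formula) : Justified l A ↔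
    (∃ B : Formula, B.code = A.code ∧ IsAxiom B) ∨
    (∃ b ∈ l.map Formula.code, impCode b A.code ∈ l.map Formula.code) ∨
    ∃ b ∈ l.map Formula.code, A.code = allCode (leftCode A.code) b := by
  refine or_congr ?_ (or_congr ?_ ?_)
  · exact ⟨fun h => ⟨A, rfl, h⟩, fun ⟨B, h, hB⟩ => Formula.code_injective h ▸ hB⟩
  · simp only [List.mem_map, exists_exists_and_eq_and, ← code_imp,
      Formula.code_injective.eq_iff, exists_eq_right]
  · simp only [List.mem_map, exists_exists_and_eq_and]
    refine exists_congr fun B => and_congr_right fun _ => ⟨?_, fun h => ⟨leftCode A.code, ?_⟩⟩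
    · rintro ⟨i, rfl⟩
      simp
    · exact Formula.code_injective h

/-- With the last formula in front, each formula is justified by the tail of the list, so list
recursion checks the whole sequence. -/
theorem primrecPred_isProofSeq :
    PrimrecPred fun c : List ℕ => ∃ l : List Formula, l.map Formula.code = c ∧ IsProofSeq l := by
  let J (l : List ℕ) (a : ℕ) : Prop := Formula.isCode a = true ∧
    ((∃ B : Formula, B.code = a ∧ IsAxiom B) ∨ (∃ b ∈ l, impCode b a ∈ l) ∨
      ∃ b ∈ l, a = allCode (leftCode a) b)
  have hmem : PrimrecRel fun (l : List ℕ) (a : ℕ) => a ∈ l :=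
    (Primrec.eq (α := ℕ)).exists_mem_list.of_eq fun l a => by simp
  have hJ : PrimrecRel J := by
    refine PrimrecPred.and (Primrec.eq.comp (primrec_formulaIsCode.comp snd) (const true)) (PrimrecPred.or
      (primrecPred_isAxiom.comp snd) (PrimrecPred.or ?_ ?_))
    · have h : PrimrecRel fun (b : ℕ) (p : List ℕ × ℕ) => impCode b p.2 ∈ p.1 :=
        hmem.comp (fst.comp snd) (primrec_impCode.comp fst (snd.comp snd))
      exact h.exists_mem_list.comp fst .id
    · have h : PrimrecRel fun (b : ℕ) (p : List ℕ × ℕ) => p.2 = allCode (leftCode p.2) b :=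
        Primrec.eq.comp (snd.comp snd)
          (primrec_allCode.comp (primrec_leftCode.comp (snd.comp snd)) fst)
      exact h.exists_mem_list.comp fst .id
  classical
  let f (c : List ℕ) : Bool := c.rec true fun a l r => decide (J l a) && r
  have hf : Primrec f := by
    refine list_rec .id (const true) (Primrec.and.comp (hJ.decide.comp
      (fst.comp (snd.comp snd)) (fst.comp snd)) (snd.comp (snd.comp snd))).to₂
  refine (Primrec.eq.comp hf (const true)).of_eq fun c => ?_
  induction c with
  | nil => exact ⟨fun _ => ⟨[], rfl, trivial⟩, fun _ => rfl⟩
  | cons a c ih =>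
    have hac : f (a :: c) = true ↔ J c a ∧ f c = true := by simp [f]
    rw [hac, ih]
    constructor
    · rintro ⟨⟨ha, hj⟩, l, rfl, hl⟩
      obtain ⟨A, rfl⟩ := (Formula.isCode_iff a).1 ha
      exact ⟨A :: l, rfl, (justified_iff l A).2 hj, hl⟩
    · rintro ⟨_ | ⟨A, l⟩, h, hl⟩
      · simp at h
      · simp only [List.map_cons, List.cons.injEq] at h
        obtain ⟨rfl, rfl⟩ := h
        exact ⟨⟨by simp, (justified_iff l A).1 hl.1⟩, l, rfl, hl.2⟩

/-- The proof relation is primitive recursive. -/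
theorem primrecRel_proofRel : PrimrecRel ProofRel := by
  have hd := Primrec.ofNat (List ℕ)
  refine PrimrecPred.of_eq (p := fun p : ℕ × ℕ => (∃ l : List Formula,
      l.map Formula.code = Denumerable.ofNat (List ℕ) p.1 ∧ IsProofSeq l) ∧
      (Denumerable.ofNat (List ℕ) p.1).head? = some p.2)
    ((primrecPred_isProofSeq.comp (hd.comp fst)).and (Primrec.eq.comp
      (list_head?.comp (hd.comp fst)) (option_some.comp snd))) fun p => ?_
  constructor
  · rintro ⟨⟨l, hl, hp⟩, hh⟩
    rw [← hl] at hh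
    cases l with
    | nil => simp at hh
    | cons A l =>
      refine ⟨A :: l, A, ?_, by simpa using hh, hp, rfl⟩
      rw [seqCode, hl, Denumerable.encode_ofNat]
  · rintro ⟨l, A, h₁, h₂, hl, hA⟩
    rw [← h₁, seqCode, Denumerable.ofNat_encode]
    exact ⟨⟨l, rfl, hl⟩, by simp [hA, h₂]⟩

theorem proofRel_code_iff (A : Formula) : (∃ y, ProofRel y A.code) ↔ Provable A := by
  constructor
  · rintro ⟨y, l, B, -, hB, h⟩
    exact ⟨l, Formula.code_injective hB ▸ h⟩
  · rintro ⟨l, h⟩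
    exact ⟨_, l, A, rfl, rfl, h⟩

/-- The Gödel number of `H(a, y)` is a primitive recursive function of `a`. -/
theorem primrec_code_nonHalting (H : Formula) : Primrec fun a => (nonHalting H a).code := by
  have hn : Primrec fun a => (Term.numeral a).code := by
    refine (nat_rec₁ (f := fun _ c => Nat.pair 2 c) Term.zero.code
      (Primrec₂.natPair.comp (const 2) snd)).of_eq fun a => ?_
    induction a with
    | zero => rfl
    | succ a ih => exact congrArg (Nat.pair 2) ih
  refine (primrec_formulaSubstCode.comp ((const 0).pair hn) (const H.code)).of_eq fun a => ?_
  rw [Formula.substCode_code]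
  rfl

end

/-! ### Turing machines -/

namespace TM

open Primrec

theorem primrec_step : Primrec₂ step := by
  let A := ((TM × Config) × (ℕ ⊕ Bool) × ℕ)
  have hc : Primrec fun q : A => q.1.2 := snd.comp fst
  have hq : Primrec fun q : A => q.2.2 := snd.comp snd
  have hl : Primrec fun q : A => q.1.2.2.1 := fst.comp (snd.comp hc)
  have hs : Primrec fun q : A => q.1.2.2.2.1 := fst.comp (snd.comp (snd.comp hc))
  have hr : Primrec fun q : A => q.1.2.2.2.2 := snd.comp (snd.comp (snd.comp hc))
  have hhead : Primrec fun l : List ℕ => l.headD 0 :=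
    (option_getD.comp list_head? (const 0)).of_eq fun l => by cases l <;> rfl
  have hact : Primrec fun q : A => act q.2.2 q.1.2.2.1 q.1.2.2.2.1 q.1.2.2.2.2 q.2.1 := by
    refine (sumCasesOn (f := fun q : A => q.2.1)
      (g := fun q s' => ((q.2.2, q.1.2.2.1, s', q.1.2.2.2.2) : Config))
      (h := fun q b => bif b
        then ((q.2.2, q.1.2.2.2.1 :: q.1.2.2.1, q.1.2.2.2.2.headD 0, q.1.2.2.2.2.tail) : Config)
        else (q.2.2, q.1.2.2.1.tail, q.1.2.2.1.headD 0, q.1.2.2.2.1 :: q.1.2.2.2.2))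
      (fst.comp snd) ?_ ?_).of_eq fun q => ?_
    · exact (hq.comp fst).pair ((hl.comp fst).pair (snd.pair (hr.comp fst)))
    · refine Primrec.cond snd
        ((hq.comp fst).pair ((list_cons.comp (hs.comp fst) (hl.comp fst)).pair
          ((hhead.comp (hr.comp fst)).pair (list_tail.comp (hr.comp fst)))))
        ((hq.comp fst).pair ((list_tail.comp (hl.comp fst)).pair
          ((hhead.comp (hl.comp fst)).pair (list_cons.comp (hs.comp fst) (hr.comp fst)))))
    · rcases q with ⟨q, (s' | b), q'⟩
      · rfl
      · cases b <;> rfl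
  have hlookup : Primrec₂ fun (p : ℕ × ℕ) (T : TM) => T.lookup p :=
    -- Two lawful `BEq` instances on pairs are involved; being lawful, they coincide.
    listLookup.of_eq fun p T => by rw [lawful_beq_subsingleton instBEqOfDecidableEq instBEqProd]
  exact option_map (hlookup.comp ((fst.comp snd).pair (fst.comp (snd.comp (snd.comp snd)))) fst)
    hact

theorem primrec_init : Primrec init := by
  have h : Primrec fun a : ℕ => List.replicate a 1 :=
    (list_map list_range (const 1).to₂).of_eq fun a => by simp
  exact (const 0).pair ((const []).pair ((const 1).pair h))

/-- The machine is an argument too, as needed for the halting problem over all pairs. -/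
theorem primrec_configAt : Primrec fun q : (TM × ℕ) × ℕ => configAt q.1.1 q.1.2 q.2 := by
  refine (nat_rec' (f := fun q : (TM × ℕ) × ℕ => q.2) (g := fun q => some (init q.1.2))
    (h := fun q p => p.2.bind (step q.1.1)) snd
    (option_some.comp (primrec_init.comp (snd.comp fst)))
    (option_bind (snd.comp snd) (primrec_step.comp (fst.comp (fst.comp (fst.comp fst)))
      snd))).of_eq fun q => ?_
  obtain ⟨q, n⟩ := q
  induction n with
  | zero => rfl
  | succ n ih => simp only [configAt, ← ih]

theorem primrecPred_repeatsBy (T : TM) : PrimrecPred fun q : ℕ × ℕ => T.RepeatsBy q.1 q.2 := by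
  have hc : Primrec₂ fun a n : ℕ => configAt T a n :=
    primrec_configAt.comp (((const T).pair fst).pair snd)
  have h₁ : PrimrecRel fun (i : ℕ) (p : ℕ × ℕ) =>
      configAt T p.1 i ≠ none ∧ configAt T p.1 i = configAt T p.1 p.2 :=
    (Primrec.eq.comp (hc.comp (fst.comp snd) fst) (const none)).not.and
      (Primrec.eq.comp (hc.comp (fst.comp snd) fst) (hc.comp (fst.comp snd) (snd.comp snd)))
  have h₂ : PrimrecRel fun (j : ℕ) (a : ℕ) => ∃ i ∈ List.range j,
      configAt T a i ≠ none ∧ configAt T a i = configAt T a j :=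
    h₁.exists_mem_list.comp (list_range.comp fst) (snd.pair fst)
  refine (h₂.exists_mem_list.comp (list_range.comp (succ.comp snd)) fst).of_eq fun q => ?_
  simp only [List.mem_range, Nat.lt_succ_iff, RepeatsBy]
  constructor
  · rintro ⟨j, hj, i, hi, h⟩
    exact ⟨i, j, hi, hj, h⟩
  · rintro ⟨i, j, hi, hj, h⟩
    exact ⟨j, hj, i, hi, h⟩

theorem configAt_eq_none_of_le {T : TM} {a m n : ℕ} (hmn : m ≤ n) (h : configAt T a m = none) :
    configAt T a n = none := by
  induction n, hmn using Nat.le_induction with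
  | base => exact h
  | succ n _ ih => rw [configAt, ih]; rfl

theorem configAt_add_congr {T : TM} {a i j : ℕ} (h : configAt T a i = configAt T a j) (k : ℕ) :
    configAt T a (i + k) = configAt T a (j + k) := by
  induction k with
  | zero => exact h
  | succ k ih => rw [← add_assoc, ← add_assoc, configAt, configAt, ih]

/-- The machine is deterministic, so from step `i` on the run has period `j - i` and never reaches
`none`. -/
theorem RepeatsBy.not_haltsOn {T : TM} {a n : ℕ} (h : T.RepeatsBy a n) : ¬ T.HaltsOn a := by
  obtain ⟨i, j, hij, -, hi, h⟩ := h
  rintro ⟨m, hm⟩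
  have hk (k : ℕ) : configAt T a (i + k * (j - i)) = configAt T a i := by
    induction k with
    | zero => simp
    | succ k ih =>
      have := configAt_add_congr h (k * (j - i))
      rw [ih] at this
      rw [this]
      congr 1
      rw [Nat.succ_mul]
      omega
  -- After `m` periods at least `m` steps have passed, since `j - i ≥ 1`; the run should have
  -- stopped by then.
  refine hi ((hk m).symm.trans (configAt_eq_none_of_le ?_ hm))
  have : m * 1 ≤ m * (j - i) := Nat.mul_le_mul_left m (by omega)
  omega

end TM

/-! ### Recursively enumerable predicates -/

/-- The projection is the domain of the unbounded search for `n`. -/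
theorem rePred_exists {α : Type*} [Primcodable α] {R : α → ℕ → Prop} (h : PrimrecRel R) :
    REPred fun a => ∃ n, R a n := by
  classical
  have hp : Partrec₂ fun (a : α) (n : ℕ) => Part.some (decide (R a n)) :=
    h.decide.to_comp.partrec
  refine (Partrec.rfind hp).dom_re.of_eq fun a => ?_
  refine Nat.rfind_dom.trans ?_
  simp

theorem rePred_haltsOn (T : TM) : REPred fun a => T.HaltsOn a :=
  rePred_exists (Primrec.eq.comp (TM.primrec_configAt.comp
    (((Primrec.const T).pair .fst).pair .snd)) (.const none))

/-- The halting of arbitrary machines, as a recursively enumerable set of numbers. -/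
theorem exists_rePred_haltsOn : ∃ p : ℕ → Prop, REPred p ∧
    ∀ q : TM × ℕ, p (Encodable.encode q) ↔ q.1.HaltsOn q.2 := by
  classical
  refine ⟨fun n => ∃ m, (Encodable.decode (α := TM × ℕ) n).map
    (fun q => decide (q.1.configAt q.2 m = none)) = some true, rePred_exists ?_, fun q => ?_⟩
  · exact Primrec.eq.comp (Primrec.option_map (Primrec.decode.comp .fst)
      (Primrec.eq.decide.comp (TM.primrec_configAt.comp (Primrec.snd.pair
        (Primrec.snd.comp Primrec.fst))) (.const none))) (.const _)
  · simp [TM.HaltsOn]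

/-! ### The thesis and the non-halting formula -/

namespace Term

theorem occurs_subst_numeral {i j n : ℕ} {t : Term}
    (h : (Term.subst i (numeral n) t).Occurs j) : j ≠ i ∧ t.Occurs j := by
  induction t with
  | var k =>
    by_cases hk : k = i
    · rw [subst, if_pos hk] at h
      exact (not_occurs_numeral j n h).elim
    · rw [subst, if_neg hk] at h
      exact ⟨fun e => hk (Eq.trans h e), h⟩
  | zero => exact h.elim
  | succ t ih => exact ih h
  | add t u iht ihu => exact h.elim (fun h => (iht h).imp_right .inl) fun h => (ihu h).imp_right .inr
  | mul t u iht ihu => exact h.elim (fun h => (iht h).imp_right .inl) fun h => (ihu h).imp_right .inr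

end Term

theorem Formula.free_subst_numeral {i j n : ℕ} {A : Formula}
    (h : (A.subst i (.numeral n)).Free j) : j ≠ i ∧ A.Free j := by
  induction A with
  | eq t u =>
    exact h.elim (fun h => (Term.occurs_subst_numeral h).imp_right .inl)
      fun h => (Term.occurs_subst_numeral h).imp_right .inr
  | neg A ih => exact ih h
  | imp A B ihA ihB =>
    exact h.elim (fun h => (ihA h).imp_right .inl) fun h => (ihB h).imp_right .inr
  | all k A ih =>
    by_cases hk : k = i
    · rw [subst, if_pos hk] at h
      exact ⟨fun e => h.1 (hk.trans e.symm), h⟩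
    · rw [subst, if_neg hk] at h
      exact ⟨(ih h.2).1, h.1, (ih h.2).2⟩

section Expresses

variable {H : Formula} {R : ℕ → ℕ → Prop} {a : ℕ}

theorem Expresses.free_nonHalting (hH : Expresses H R) {j : ℕ} (h : (nonHalting H a).Free j) :
    j = 1 :=
  have ⟨h₁, h₂⟩ := Formula.free_subst_numeral h
  (hH.1 j h₂).resolve_left h₁

/-- PA proves or refutes each numerical instance in accordance with `R`, and what it proves is true.
-/
theorem Expresses.holdsAt_iff (hH : Expresses H R) (y : ℕ) :
    HoldsAt (nonHalting H a) 1 y ↔ R a y := by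
  rw [HoldsAt, ← Formula.sat_subst_numeral]
  constructor
  · intro h
    by_contra hR
    exact ((hH.2 a y).2 hR).sat (fun _ => 0) h
  · exact fun hR => ((hH.2 a y).1 hR).sat _

theorem Expresses.of_provable (hH : Expresses H R) (h : Provable (nonHalting H a)) (y : ℕ) :
    R a y := (hH.holdsAt_iff y).1 (h.sat _)

/-- If the thesis holds for `H(a, y)`, then PA proves this formula as soon as it is true for
every `y`. -/
theorem Expresses.provable (hH : Expresses H R) (hC : CCMAt (nonHalting H a) 1)
    (h : ∀ y, R a y) : Provable (nonHalting H a) := by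
  -- Uniform truth asks only that some program compute the truth values; as all of them are true,
  -- the constant program qualifies.
  refine hC.2 ⟨.const 1, fun k => ?_, fun k => Nat.Partrec.Code.eval_const 1 k⟩
  rw [if_pos ((hH.holdsAt_iff k).2 (h k)), Nat.Partrec.Code.eval_const]

end Expresses

/-! ### The two programs and their parallel run -/

theorem exists_code_eval {f : ℕ → ℕ → ℕ} (hf : Computable₂ f) :
    ∃ c : Nat.Partrec.Code, ∀ a y, c.eval (Nat.pair a y) = Part.some (f a y) := by
  have h : Computable fun n : ℕ => f n.unpair.1 n.unpair.2 :=
    hf.comp (Computable.fst.comp .unpair) (Computable.snd.comp .unpair)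
  obtain ⟨c, hc⟩ := Nat.Partrec.Code.exists_code.1 (Partrec.nat_iff.1 h.partrec)
  exact ⟨c, fun a y => by simp [hc]⟩

theorem Presents.exists_isDuo {T : TM} {G : ℕ → ℕ → ℕ} {H : Formula} (h : Presents T G H) :
    ∃ T₁ T₂, IsDuo T G H T₁ T₂ := by
  classical
  have h₁ : Computable₂ fun a y => if G a y = 0 then 0 else if T.RepeatsBy a y then 2 else 1 := by
    refine (Computable.cond (Primrec.eq.decide.to_comp.comp h.computable (.const 0)) (.const 0)
      (Computable.cond (T.primrecPred_repeatsBy.decide.to_comp) (.const 2)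
        (.const 1))).of_eq fun q => ?_
    simp [Bool.cond_decide]
  have h₂ : Computable₂ fun a y => if ProofRel y (nonHalting H a).code then 0 else 1 :=
    (Primrec.ite (primrecRel_proofRel.comp .snd ((primrec_code_nonHalting H).comp .fst))
      (.const 0) (.const 1)).to_comp
  obtain ⟨T₁, hT₁⟩ := exists_code_eval h₁
  obtain ⟨T₂, hT₂⟩ := exists_code_eval h₂
  exact ⟨T₁, T₂, fun a y => (hT₁ a y).trans (by congr), fun a y => (hT₂ a y).trans (by congr)⟩

section Parallel

variable {T : TM} {G : ℕ → ℕ → ℕ} {H : Formula} {T₁ T₂ : Nat.Partrec.Code} {a : ℕ}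

open Classical in
theorem IsDuo.parallel_eq (h : IsDuo T G H T₁ T₂) (a : ℕ) : parallel T₁ T₂ a =
    (Nat.rfind fun y => Part.some (decide ((G a y = 0 ∨ T.RepeatsBy a y) ∨
      ProofRel y (nonHalting H a).code))).bind fun y => Part.some (decide (G a y = 0)) := by
  have h₁ (y : ℕ) : (if G a y = 0 then 0 else if T.RepeatsBy a y then 2 else 1) = 0 ↔
      G a y = 0 := by split_ifs <;> simp_all
  have h₂ (y : ℕ) : (if G a y = 0 then 0 else if T.RepeatsBy a y then 2 else 1) ≠ 1 ↔
      G a y = 0 ∨ T.RepeatsBy a y := by split_ifs <;> simp_all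
  have h₃ (y : ℕ) : (if ProofRel y (nonHalting H a).code then 0 else 1) = 0 ↔
      ProofRel y (nonHalting H a).code := by split_ifs <;> simp_all
  simp only [parallel, h.first, h.second, Part.bind_some, Part.map_some, h₁, h₂, h₃]

theorem IsDuo.parallel_dom (h : IsDuo T G H T₁ T₂) {y : ℕ} (hy : (G a y = 0 ∨ T.RepeatsBy a y) ∨
    ProofRel y (nonHalting H a).code) : (parallel T₁ T₂ a).Dom := by
  classical
  rw [h.parallel_eq, Part.bind_some_eq_map]
  obtain ⟨n, hn, -⟩ := Nat.rfind_min' (p := fun y => decide ((G a y = 0 ∨ T.RepeatsBy a y) ∨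
      ProofRel y (nonHalting H a).code)) (m := y) (decide_eq_true hy)
  have hdom : (Nat.rfind _).Dom := Part.dom_iff_mem.2 ⟨n, hn⟩
  exact hdom

/-- Only halting needs an argument, as the answer `true` comes with a zero of `G`. If `T` halts, a
repetition is impossible, and so by soundness is a proof of `H(a, y)`; the search can then have
stopped only at a zero. -/
theorem IsDuo.parallel_correct (hT : Presents T G H) (h : IsDuo T G H T₁ T₂) {b : Bool}
    (hb : b ∈ parallel T₁ T₂ a) : b = true ↔ T.HaltsOn a := by
  classical
  rw [h.parallel_eq, Part.mem_bind_iff] at hb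
  obtain ⟨y, hy, hb⟩ := hb
  have hy := Nat.rfind_spec hy
  rw [Part.mem_some_iff] at hy hb
  rw [hb, decide_eq_true_eq]
  constructor
  · exact fun hG => (hT.halts_iff a).2 ⟨y, hG⟩
  · intro hH
    rcases of_decide_eq_true hy.symm with (hG | hR) | hP
    · exact hG
    · exact (hR.not_haltsOn hH).elim
    · obtain ⟨z, hz⟩ := (hT.halts_iff a).1 hH
      exact (hT.expresses.of_provable ((proofRel_code_iff _).1 ⟨y, hP⟩) z hz).elim

theorem IsDuo.parallel_dom_of_ccmAt (hT : Presents T G H) (h : IsDuo T G H T₁ T₂)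
    (hC : CCMAt (nonHalting H a) 1) : (parallel T₁ T₂ a).Dom := by
  by_cases hG : ∃ y, G a y = 0
  · obtain ⟨y, hy⟩ := hG
    exact h.parallel_dom (.inl (.inl hy))
  · obtain ⟨y, hy⟩ := (proofRel_code_iff _).2 (hT.expresses.provable hC (not_exists.1 hG))
    exact h.parallel_dom (.inr hy)

end Parallel

/-- Every Turing machine has a recursive presentation of its halting that is expressible in PA. -/
theorem exists_presents (T : TM) : ∃ (G : ℕ → ℕ → ℕ) (H : Formula), Presents T G H := by
  obtain ⟨G, H, hG, hT, hH⟩ := exists_expresses_of_rePred (rePred_haltsOn T)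
  exact ⟨G, H, hG, hT, hH⟩

theorem CCMThesis.ccmAt_nonHalting (hC : CCMThesis) {H : Formula} {R : ℕ → ℕ → Prop}
    (hH : Expresses H R) (a : ℕ) : CCMAt (nonHalting H a) 1 :=
  hC _ 1 fun _ => hH.free_nonHalting

/-- Under the thesis the halting problem is decidable: both halting and, through the provability
of `H(a, y)`, non-halting are recursively enumerable. -/
theorem CCMThesis.computablePred_haltsOn (hC : CCMThesis) :
    ComputablePred fun p : TM × ℕ => p.1.HaltsOn p.2 := by
  -- Formulas chosen for each machine separately would not yield a uniform procedure. One set of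
  -- numbers codes the halting of all machines, so a single `H` covers all pairs.
  obtain ⟨p, hp, hpT⟩ := exists_rePred_haltsOn
  obtain ⟨G, H, -, hG, hH⟩ := exists_expresses_of_rePred hp
  -- Post's theorem: a set is decidable if it and its complement are recursively enumerable.
  refine ComputablePred.computable_iff_re_compl_re'.2 ⟨?_, ?_⟩
  · exact REPred.of_eq (p := fun q => p (Encodable.encode q)) (Partrec.comp hp .encode) hpT
  · have hR : PrimrecRel fun (q : TM × ℕ) y =>
        ProofRel y (nonHalting H (Encodable.encode q)).code :=
      primrecRel_proofRel.comp .snd ((primrec_code_nonHalting H).comp (Primrec.encode.comp .fst))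
    refine (rePred_exists hR).of_eq fun q => ?_
    rw [proofRel_code_iff, ← hpT, hG, not_exists]
    exact ⟨hH.of_provable, hH.provable (hC.ccmAt_nonHalting hH _)⟩

end HaltPA

/-! ### The theorem -/

theorem theorem1 :
    -- the two programs exist, whatever the representation of the halting of a machine `T`
    (∀ (T : TM) (G : ℕ → ℕ → ℕ) (H : Formula), Presents T G H →
      ∃ T₁ T₂ : Nat.Partrec.Code, IsDuo T G H T₁ T₂) ∧
    -- run in parallel they never err, and one of them stops on each input for which the thesis
    -- holds of `H(a, y)`, and on each input on which `T` repeats an instantaneous description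
    (∀ (T : TM) (G : ℕ → ℕ → ℕ) (H : Formula) (T₁ T₂ : Nat.Partrec.Code),
      Presents T G H → IsDuo T G H T₁ T₂ →
      ∀ a : ℕ,
        (∀ b ∈ parallel T₁ T₂ a, b = true ↔ T.HaltsOn a) ∧
        (CCMAt (nonHalting H a) 1 → (parallel T₁ T₂ a).Dom) ∧
        ((∃ n, T.RepeatsBy a n) → (parallel T₁ T₂ a).Dom)) ∧
    -- under the thesis, every machine has such a pair of programs, the pair decides its halting on
    -- every input, and the halting problem is decidable
    (CCMThesis →
      (∀ T : TM, ∃ (G : ℕ → ℕ → ℕ) (H : Formula), Presents T G H) ∧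
      (∀ (T : TM) (G : ℕ → ℕ → ℕ) (H : Formula) (T₁ T₂ : Nat.Partrec.Code),
        Presents T G H → IsDuo T G H T₁ T₂ →
        ∀ a : ℕ, ∃ b ∈ parallel T₁ T₂ a, (b = true ↔ T.HaltsOn a)) ∧
      ComputablePred fun p : TM × ℕ => p.1.HaltsOn p.2) := by
  refine ⟨fun T G H h => h.exists_isDuo, fun T G H T₁ T₂ hT hD a => ⟨fun b hb =>
    hD.parallel_correct hT hb, hD.parallel_dom_of_ccmAt hT, fun ⟨n, hn⟩ =>
    hD.parallel_dom (.inl (.inr hn))⟩, fun hC => ⟨exists_presents, fun T G H T₁ T₂ hT hD a => ?_,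
    hC.computablePred_haltsOn⟩⟩
  obtain ⟨b, hb⟩ := Part.dom_iff_mem.1
    (hD.parallel_dom_of_ccmAt hT (hC.ccmAt_nonHalting hT.expresses a))
  exact ⟨b, hb, hD.parallel_correct hT hb⟩
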